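/- There are constants $C,c>0$ such that the following holds for every integer $N\ge 2$. A centered complex Gaussian variable of variance $v$ means $x+\mathrm{i}y$ with $x,y$ independent real centered Gaussian variables of variance $v/2$. (a) Let $Y_1,\dots,Y_N$ be independent $N\times N$ random matrices, all of whose entries are i.i.d. centered complex Gaussian variables of variance $1/N$. With probability at least $1-e^{-cN}$ we have, for all $(a_{ii'})\in\mathbb C^{N\times N}$, $$\Big\|\sum_{i,i'=1}^N a_{ii'}\,Y_i\otimes Y_{i'}\Big\|\le C(\log N)^{3/2}\Big(\sum_{i,i'=1}^N|a_{ii'}|^2\Big)^{1/2},$$ where the norm on the left is the operator norm on $\ell_2^N\otimes_2\ell_2^N=\ell_2^{N^2}$. (b) Let $Y_1,\dots,Y_N,Y'_1,\dots,Y'_N$ be independent $N\times N$ random matrices, all of whose entries are i.i.d. centered Gaussian variables of variance $1/N$, either all real or all complex. With probability at least $1-e^{-cN}$ we have, for all $(a_{ii'})\in\mathbb C^{N\times N}$, $$\Big\|\sum_{i,i'=1}^N a_{ii'}\,Y_i\otimes Y'_{i'}\Big\|\le C(\log N)^{3/2}\Big(\sum_{i,i'=1}^N|a_{ii'}|^2\Big)^{1/2}.$$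 (c) Let $(g_{ikl})_{1\le i,k,l\le N}$ and $(g'_{ikl})_{1\le i,k,l\le N}$ be, together, $2N^3$ i.i.d. centered Gaussian variables of variance $1$, either all real or all complex. Let $(e_{ij})_{1\le i,j\le N}$ be the canonical basis of the complex Hilbert space $\ell_2^{N^2}$, and let $$T=\sum_{i,k,l,i',k',l'=1}^N g_{ikl}\,g'_{i'k'l'}\;e_{ii'}\otimes e_{kk'}\otimes e_{ll'},$$ with norm $\|T\|_\vee$ in the injective tensor product $\ell_2^{N^2}\check\otimes\ell_2^{N^2}\check\otimes\ell_2^{N^2}$, that is, the supremum of $|(\varphi\otimes\psi\otimes\chi)(T)|$ over linear forms $\varphi,\psi,\chi$ of norm at most $1$ on $\ell_2^{N^2}$. Then $\|T\|_\vee$ is integrable, $$\mathbb E\|T\|_\vee\le C\,N(\log N)^{3/2}\qquad\text{and}\qquad \mathbb P\big(\|T\|_\vee>C\,N(\log N)^{3/2}\big)\le e^{-cN}.$$ -/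

import Mathlib

open MeasureTheory ProbabilityTheory TensorProduct
open scoped NNReal ENNReal Kronecker

noncomputable section

namespace GaussTensor

/-- The real centered Gaussian law of variance `v`, carried by the real line inside `ℂ`. -/
def realGaussian (v : ℝ≥0) : Measure ℂ :=
  (gaussianReal 0 v).map (fun x : ℝ => (x : ℂ))

/-- The complex (circular) centered Gaussian law with `E|z|² = v`: the real and imaginary parts
are independent centered real Gaussian variables of variance `v / 2`. -/
def complexGaussian (v : ℝ≥0) : Measure ℂ :=
  ((gaussianReal 0 (v / 2)).prod (gaussianReal 0 (v / 2))).map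
    (fun p : ℝ × ℝ => (⟨p.1, p.2⟩ : ℂ))

/-- `X` is a family of i.i.d. random variables, each with law `ν`. -/
def IsIID {ι Ω : Type*} [MeasurableSpace Ω] (X : ι → Ω → ℂ) (ν : Measure ℂ)
    (P : Measure Ω) : Prop :=
  (∀ i, HasLaw (X i) ν P) ∧ iIndepFun X P

/-- All the entries of the matrices `Y i`, as one family of random variables. -/
def entries {N : ℕ} {Ω : Type*} (Y : Fin N → Ω → Matrix (Fin N) (Fin N) ℂ) :
    Fin N × Fin N × Fin N → Ω → ℂ :=
  fun p ω => Y p.1 ω p.2.1 p.2.2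

/-- The operator norm of `A`, acting on the Hilbert space `ℓ₂ⁿ`. -/
def opNorm {n : Type*} [Fintype n] [DecidableEq n] (A : Matrix n n ℂ) : ℝ :=
  ‖Matrix.toEuclideanCLM (𝕜 := ℂ) A‖

/-- The Euclidean norm `(∑ |a_{ii'}|²)^{1/2}` of a square array of scalars. -/
def hsNorm {N : ℕ} (a : Fin N → Fin N → ℂ) : ℝ :=
  Real.sqrt (∑ i, ∑ i', ‖a i i'‖ ^ 2)

/-- The linear form `φ ⊗ ψ ⊗ χ` on a triple tensor product,
`x ⊗ y ⊗ z ↦ φ x * (ψ y * χ z)`. -/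
def tripleForm {E F G : Type*}
    [NormedAddCommGroup E] [NormedSpace ℂ E] [NormedAddCommGroup F] [NormedSpace ℂ F]
    [NormedAddCommGroup G] [NormedSpace ℂ G]
    (φ : E →L[ℂ] ℂ) (ψ : F →L[ℂ] ℂ) (χ : G →L[ℂ] ℂ) : E ⊗[ℂ] (F ⊗[ℂ] G) →ₗ[ℂ] ℂ :=
  LinearMap.mul' ℂ ℂ ∘ₗ TensorProduct.map (φ : E →ₗ[ℂ] ℂ)
    (LinearMap.mul' ℂ ℂ ∘ₗ TensorProduct.map (ψ : F →ₗ[ℂ] ℂ) (χ : G →ₗ[ℂ] ℂ))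

/-- The injective norm of an element of a triple algebraic tensor product: the supremum of
`|(φ ⊗ ψ ⊗ χ) t|` over `φ, ψ, χ` in the unit balls of the duals. -/
def injectiveNorm {E F G : Type*}
    [NormedAddCommGroup E] [NormedSpace ℂ E] [NormedAddCommGroup F] [NormedSpace ℂ F]
    [NormedAddCommGroup G] [NormedSpace ℂ G] (t : E ⊗[ℂ] (F ⊗[ℂ] G)) : ℝ :=
  sSup {r : ℝ | ∃ (φ : E →L[ℂ] ℂ) (ψ : F →L[ℂ] ℂ) (χ : G →L[ℂ] ℂ),
    ‖φ‖ ≤ 1 ∧ ‖ψ‖ ≤ 1 ∧ ‖χ‖ ≤ 1 ∧ r = ‖tripleForm φ ψ χ t‖}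

/-- The Hilbert space `ℓ₂^{N²}`, with coordinates indexed by pairs. -/
abbrev EllTwoSq (N : ℕ) : Type := EuclideanSpace ℂ (Fin N × Fin N)

/-- The canonical basis vector `e_{ij}` of `ℓ₂^{N²}`. -/
def e {N : ℕ} (i j : Fin N) : EllTwoSq N := EuclideanSpace.single (i, j) (1 : ℂ)

/-- The tensor `∑ x_{ikl} y_{i'k'l'} e_{ii'} ⊗ e_{kk'} ⊗ e_{ll'}`. -/
def bigTensor {N : ℕ} (x y : Fin N × Fin N × Fin N → ℂ) :
    EllTwoSq N ⊗[ℂ] (EllTwoSq N ⊗[ℂ] EllTwoSq N) :=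
  ∑ i, ∑ k, ∑ l, ∑ i', ∑ k', ∑ l',
    (x (i, k, l) * y (i', k', l')) • (e i i' ⊗ₜ[ℂ] (e k k' ⊗ₜ[ℂ] e l l'))

end GaussTensor

end

/-! All three parts reduce to one estimate: for unit-variance Gaussian arrays `x`, `y` (equal in
part (a)), the form `trip x y φ ψ χ` is at most a constant times `N (log N)^(3/2)` on the product of
three Hilbert–Schmidt unit balls of `N × N` matrices.

Each matrix splits along dyadic blocks of its singular values into pieces `c_j A_j B_jᴴ` with `A_j`,
`B_j` contractions of inner dimension `2 ^ j` (`exists_flat_decomposition`). Cauchy–Schwarz over the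
`L ~ log N` blocks costs a factor `√L` for each of the three arguments, whence `(log N)^(3/2)`. It
remains to bound the form on flat pieces of ranks `2^i, 2^j, 2^k` by a constant times `N m`, where
`m² = 2^(i+j+k)`.

On flat pieces the form factors through a space of dimension `m²`, so its exponential moment at `l`
is at most `exp (8 m² l²)` for bounded `l`. For independent arrays this is Gaussian linearisation
(`SubGauss.lintegral_exp_bilin_le`); for one complex array, a decoupling argument
(`lintegral_exp_quadratic_le`). With `ρ = 2 ^ max i j k`, nets for the contractions have `exp (O(N
ρ))` points, so a Chernoff bound needs `l ~ ρ / m`, which is bounded only if `ρ ≤ m`, as holds when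
no exponent exceeds the sum of the other two. In the other cases the form sees only part of the
largest piece, whose rank can be cut to the product of the other two (`exists_trip_rank_reduction`).

The union bound is carried by a random variable, `totalWeight`, with mean at most `exp (-N)`. It
controls the form deterministically (`norm_trip_le_totalWeight`), which yields both the tail and the
expectation. -/

noncomputable section

namespace GaussTensor

section Gaussian

variable {ι κ α : Type*} [Fintype ι] [Fintype κ] [Fintype α]

/-! ### Gaussian exponential integrals -/

lemma lintegral_exp_mul_gaussianReal (v : ℝ≥0) (t : ℝ) :
    ∫⁻ x, ENNReal.ofReal (Real.exp (t * x)) ∂(gaussianReal 0 v)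
      = ENNReal.ofReal (Real.exp (v * t ^ 2 / 2)) := by
  rw [← ofReal_integral_eq_lintegral_ofReal (integrable_exp_mul_gaussianReal t)
    (ae_of_all _ fun x => (Real.exp_pos _).le)]
  have h := mgf_gaussianReal (p := gaussianReal 0 v) (X := id) (μ := 0) (v := v) (by simp) t
  simp only [mgf, id] at h
  rw [h]
  simp

lemma lintegral_exp_sq_gaussianReal {s : ℝ} (hs : s < 1) :
    ∫⁻ x, ENNReal.ofReal (Real.exp (s * x ^ 2 / 2)) ∂(gaussianReal 0 1)
      = ENNReal.ofReal ((√(1 - s))⁻¹) := by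
  have hb : 0 < (1 - s) / 2 := by linarith
  rw [gaussianReal_of_var_ne_zero _ one_ne_zero,
    lintegral_withDensity_eq_lintegral_mul _ (measurable_gaussianPDF _ _) (by fun_prop)]
  have : ∀ x : ℝ, (gaussianPDF 0 1 * fun x => ENNReal.ofReal (Real.exp (s * x ^ 2 / 2))) x
      = ENNReal.ofReal ((√(2 * Real.pi))⁻¹ * Real.exp (-((1 - s) / 2) * x ^ 2)) := by
    intro x
    simp only [Pi.mul_apply, gaussianPDF, gaussianPDFReal]
    rw [← ENNReal.ofReal_mul (by positivity), mul_assoc, ← Real.exp_add]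
    congr 3
    · simp
    · simp; ring
  simp_rw [this]
  rw [← ofReal_integral_eq_lintegral_ofReal ((integrable_exp_neg_mul_sq hb).const_mul _)
    (ae_of_all _ fun x => by positivity), integral_const_mul, integral_gaussian]
  congr 1
  rw [← Real.sqrt_inv, ← Real.sqrt_inv, ← Real.sqrt_mul (by positivity)]
  congr 1
  have : 1 - s ≠ 0 := by linarith
  field_simp

instance (v : ℝ≥0) : IsProbabilityMeasure (realGaussian v) :=
  Measure.isProbabilityMeasure_map (by fun_prop)

lemma measurable_complex_mk : Measurable fun p : ℝ × ℝ => (⟨p.1, p.2⟩ : ℂ) :=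
  Complex.measurableEquivRealProd.symm.measurable

instance (v : ℝ≥0) : IsProbabilityMeasure (complexGaussian v) :=
  Measure.isProbabilityMeasure_map measurable_complex_mk.aemeasurable

lemma lintegral_exp_realGaussian (v : ℝ≥0) (c : ℂ) :
    ∫⁻ z, ENNReal.ofReal (Real.exp (c * z).re) ∂(realGaussian v)
      = ENNReal.ofReal (Real.exp (v * c.re ^ 2 / 2)) := by
  rw [realGaussian, lintegral_map (by fun_prop) (by fun_prop), ← lintegral_exp_mul_gaussianReal]
  simp

lemma lintegral_exp_complexGaussian (v : ℝ≥0) (c : ℂ) :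
    ∫⁻ z, ENNReal.ofReal (Real.exp (c * z).re) ∂(complexGaussian v)
      = ENNReal.ofReal (Real.exp (v * ‖c‖ ^ 2 / 4)) := by
  rw [complexGaussian, lintegral_map (by fun_prop) measurable_complex_mk]
  have : ∀ p : ℝ × ℝ, ENNReal.ofReal (Real.exp (c * (⟨p.1, p.2⟩ : ℂ)).re)
      = ENNReal.ofReal (Real.exp (c.re * p.1)) * ENNReal.ofReal (Real.exp ((-c.im) * p.2)) := by
    intro p
    rw [← ENNReal.ofReal_mul (by positivity), ← Real.exp_add]
    congr 2
    simp; ring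
  simp_rw [this]
  rw [lintegral_prod_mul (f := fun x => ENNReal.ofReal (Real.exp (c.re * x)))
    (g := fun x => ENNReal.ofReal (Real.exp (-c.im * x))) (by fun_prop) (by fun_prop),
    lintegral_exp_mul_gaussianReal, lintegral_exp_mul_gaussianReal, ← ENNReal.ofReal_mul (by positivity), ← Real.exp_add,
    ← Complex.normSq_eq_norm_sq, Complex.normSq_apply]
  congr 2
  push_cast
  ring

/-- The integral equals `(1 - s)⁻¹`, and `(1 - s) (1 + 2 s) ≥ 1` on `[0, 1/2]`. -/
lemma lintegral_exp_norm_sq_complexGaussian {s : ℝ} (h0 : 0 ≤ s) (hs : s ≤ 1 / 2) :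
    ∫⁻ z, ENNReal.ofReal (Real.exp (s * ‖z‖ ^ 2 / 2)) ∂(complexGaussian 2)
      ≤ ENNReal.ofReal (Real.exp (2 * s)) := by
  rw [complexGaussian, lintegral_map (by fun_prop) measurable_complex_mk]
  have : ∀ p : ℝ × ℝ, ENNReal.ofReal (Real.exp (s * ‖(⟨p.1, p.2⟩ : ℂ)‖ ^ 2 / 2))
      = ENNReal.ofReal (Real.exp (s * p.1 ^ 2 / 2))
        * ENNReal.ofReal (Real.exp (s * p.2 ^ 2 / 2)) := by
    intro p
    rw [← ENNReal.ofReal_mul (by positivity), ← Real.exp_add, ← Complex.normSq_eq_norm_sq,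
      Complex.normSq_apply]
    congr 2
    ring
  simp_rw [this]
  have h2 : (2 : ℝ≥0) / 2 = 1 := by simp
  rw [lintegral_prod_mul (f := fun x => ENNReal.ofReal (Real.exp (s * x ^ 2 / 2)))
    (g := fun x => ENNReal.ofReal (Real.exp (s * x ^ 2 / 2))) (by fun_prop) (by fun_prop), h2,
    lintegral_exp_sq_gaussianReal (by linarith), ← ENNReal.ofReal_mul (by positivity)]
  apply ENNReal.ofReal_le_ofReal
  rw [← mul_inv, Real.mul_self_sqrt (by linarith)]
  rw [inv_le_comm₀ (by linarith) (Real.exp_pos _), ← Real.exp_neg]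
  have h3 : (1 : ℝ) + 2 * s ≤ Real.exp (2 * s) := by linarith [Real.add_one_le_exp (2 * s)]
  rw [Real.exp_neg, inv_le_comm₀ (Real.exp_pos _) (by linarith)]
  refine le_trans ?_ h3
  rw [inv_le_iff_one_le_mul₀ (by linarith)]
  nlinarith

lemma lintegral_prod_pi (μ : ι → Measure ℂ) [∀ i, IsProbabilityMeasure (μ i)]
    {f : ι → ℂ → ℝ≥0∞} (hf : ∀ i, Measurable (f i)) :
    ∫⁻ x, ∏ i, f i (x i) ∂(Measure.pi μ) = ∏ i, ∫⁻ z, f i z ∂(μ i) := by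
  rw [lintegral_prod_eq_prod_lintegral_of_indepFun Finset.univ
    (fun i (x : ι → ℂ) => f i (x i)) (iIndepFun_pi fun i => (hf i).aemeasurable)
    (fun i => (hf i).comp (measurable_pi_apply i))]
  refine Finset.prod_congr rfl fun i _ => ?_
  exact (measurePreserving_eval μ i).lintegral_comp (hf i)

lemma ofReal_exp_sum (f : ι → ℝ) :
    ENNReal.ofReal (Real.exp (∑ i, f i)) = ∏ i, ENNReal.ofReal (Real.exp (f i)) := by
  rw [Real.exp_sum, ENNReal.ofReal_prod_of_nonneg fun i _ => (Real.exp_pos _).le]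

/-! ### Sub-Gaussian vectors and bilinear forms in them -/

/-- A law on `ℂ^ι` whose linear functionals have the exponential moments of a Gaussian vector. -/
def SubGauss (μ : Measure (ι → ℂ)) : Prop :=
  ∀ c : ι → ℂ, ∫⁻ x, ENNReal.ofReal (Real.exp (x ⬝ᵥ c).re) ∂μ
    ≤ ENNReal.ofReal (Real.exp ((∑ i, ‖c i‖ ^ 2) / 2))

lemma lintegral_exp_dotProduct_pi (μ : Measure ℂ) [IsProbabilityMeasure μ] (c : ι → ℂ) :
    ∫⁻ x, ENNReal.ofReal (Real.exp (x ⬝ᵥ c).re) ∂(Measure.pi fun _ : ι => μ)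
      = ∏ i, ∫⁻ z, ENNReal.ofReal (Real.exp (c i * z).re) ∂μ := by
  simp only [dotProduct, Complex.re_sum, ofReal_exp_sum]
  rw [← lintegral_prod_pi (fun _ => μ) fun i => by fun_prop]
  simp only [mul_comm]

lemma subGauss_pi_realGaussian : SubGauss (Measure.pi fun _ : ι => realGaussian 1) := by
  intro c
  rw [lintegral_exp_dotProduct_pi, Finset.sum_div, ofReal_exp_sum]
  refine Finset.prod_le_prod' fun i _ => ?_
  rw [lintegral_exp_realGaussian]
  refine ENNReal.ofReal_le_ofReal (Real.exp_le_exp.2 ?_)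
  have := Complex.abs_re_le_norm (c i)
  have := sq_le_sq' (neg_le_of_abs_le this) (le_of_abs_le this)
  simp only [NNReal.coe_one]
  linarith

lemma subGauss_pi_complexGaussian : SubGauss (Measure.pi fun _ : ι => complexGaussian 1) := by
  intro c
  rw [lintegral_exp_dotProduct_pi, Finset.sum_div, ofReal_exp_sum]
  refine Finset.prod_le_prod' fun i _ => ?_
  rw [lintegral_exp_complexGaussian]
  refine ENNReal.ofReal_le_ofReal (Real.exp_le_exp.2 ?_)
  simp only [NNReal.coe_one]
  nlinarith [sq_nonneg ‖c i‖]

/-- A rectangular matrix that acts as a contraction between Hilbert spaces. -/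
def IsContraction (A : Matrix ι α ℂ) : Prop :=
  ∀ h : α → ℂ, ∑ i, ‖(A.mulVec h) i‖ ^ 2 ≤ ∑ a, ‖h a‖ ^ 2

lemma SubGauss.lintegral_exp_le {μ : Measure (ι → ℂ)} (hμ : SubGauss μ) {A : Matrix ι α ℂ}
    (hA : IsContraction A) (t : ℝ) (w : α → ℂ) :
    ∫⁻ x, ENNReal.ofReal (Real.exp (t * (A.vecMul x ⬝ᵥ w).re)) ∂μ
      ≤ ENNReal.ofReal (Real.exp (t ^ 2 * (∑ a, ‖w a‖ ^ 2) / 2)) := by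
  have h := hμ ((t : ℂ) • A.mulVec w)
  simp only [dotProduct_smul, Matrix.dotProduct_mulVec, smul_eq_mul, Complex.re_ofReal_mul] at h
  refine h.trans (ENNReal.ofReal_le_ofReal (Real.exp_le_exp.2 ?_))
  simp only [Pi.smul_apply, smul_eq_mul, norm_mul, mul_pow, Complex.norm_real, Real.norm_eq_abs,
    sq_abs, ← Finset.mul_sum]
  have := hA w
  gcongr

lemma lintegral_exp_sum_norm_sq_le {t : ℝ} (ht : t ^ 2 ≤ 1 / 2) :
    ∫⁻ h, ENNReal.ofReal (Real.exp (t ^ 2 * (∑ a, ‖h a‖ ^ 2) / 2))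
        ∂(Measure.pi fun _ : α => complexGaussian 2)
      ≤ ENNReal.ofReal (Real.exp (2 * Fintype.card α * t ^ 2)) := by
  simp only [Finset.mul_sum, Finset.sum_div, ofReal_exp_sum]
  rw [lintegral_prod_pi (fun _ => complexGaussian 2)
    (f := fun _ z => ENNReal.ofReal (Real.exp (t ^ 2 * ‖z‖ ^ 2 / 2))) fun i => by fun_prop]
  have h : Real.exp (2 * Fintype.card α * t ^ 2) = Real.exp (∑ _a : α, 2 * t ^ 2) := by
    congr 1
    simp; ring
  rw [h, ofReal_exp_sum]
  exact Finset.prod_le_prod' fun a _ => lintegral_exp_norm_sq_complexGaussian (sq_nonneg t) ht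

/-- Linearisation: the exponential of a squared norm becomes an average of exponentials of linear
forms, to which `SubGauss` applies. Variance `2` makes the exponent come out exactly. -/
lemma ofReal_exp_norm_sq_eq_lintegral (t : ℝ) (w : α → ℂ) :
    ENNReal.ofReal (Real.exp (t ^ 2 * (∑ a, ‖w a‖ ^ 2) / 2))
      = ∫⁻ h, ENNReal.ofReal (Real.exp (t * (w ⬝ᵥ h).re))
          ∂(Measure.pi fun _ : α => complexGaussian 2) := by
  have h := lintegral_exp_dotProduct_pi (complexGaussian 2) ((t : ℂ) • w)
  simp only [dotProduct_smul, smul_eq_mul, Complex.re_ofReal_mul] at h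
  simp only [dotProduct_comm w, h, lintegral_exp_complexGaussian]
  rw [← ofReal_exp_sum]
  congr 2
  rw [Finset.mul_sum, Finset.sum_div]
  refine Finset.sum_congr rfl fun a _ => ?_
  simp only [Pi.smul_apply, smul_eq_mul, norm_mul, mul_pow, Complex.norm_real, Real.norm_eq_abs,
    sq_abs]
  push_cast
  ring

lemma measurable_vecMul (A : Matrix ι α ℂ) : Measurable fun x : ι → ℂ => A.vecMul x := by
  have : Continuous fun x : ι → ℂ => A.vecMul x := by fun_prop
  exact this.measurable

/-- Exponential moments of the bilinear form `∑ (Aᵀx)_a (Bᵀy)_a` in two independent vectors. -/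
lemma SubGauss.lintegral_exp_bilin_le {μ : Measure (ι → ℂ)} {ν : Measure (κ → ℂ)}
    [SFinite μ] [SFinite ν] (hμ : SubGauss μ) (hν : SubGauss ν)
    {A : Matrix ι α ℂ} {B : Matrix κ α ℂ} (hA : IsContraction A) (hB : IsContraction B)
    {t : ℝ} (ht : t ^ 2 ≤ 1 / 2) :
    ∫⁻ p, ENNReal.ofReal (Real.exp (t * (A.vecMul p.1 ⬝ᵥ B.vecMul p.2).re)) ∂(μ.prod ν)
      ≤ ENNReal.ofReal (Real.exp (2 * Fintype.card α * t ^ 2)) := by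
  have mdot : Measurable fun q : (α → ℂ) × (α → ℂ) => q.1 ⬝ᵥ q.2 := by
    have : Continuous fun q : (α → ℂ) × (α → ℂ) => q.1 ⬝ᵥ q.2 := by fun_prop
    exact this.measurable
  have m1 : Measurable fun p : (ι → ℂ) × (κ → ℂ) =>
      ENNReal.ofReal (Real.exp (t * (A.vecMul p.1 ⬝ᵥ B.vecMul p.2).re)) := by
    have := mdot.comp (((measurable_vecMul A).comp measurable_fst).prodMk
      ((measurable_vecMul B).comp (measurable_snd (α := ι → ℂ))))
    simp only [Function.comp_def] at this
    fun_prop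
  have m2 : Measurable fun p : (κ → ℂ) × (α → ℂ) =>
      ENNReal.ofReal (Real.exp (t * (B.vecMul p.1 ⬝ᵥ p.2).re)) := by
    have := mdot.comp (((measurable_vecMul B).comp measurable_fst).prodMk
      (measurable_snd (α := κ → ℂ)))
    simp only [Function.comp_def] at this
    fun_prop
  rw [lintegral_prod_symm _ m1.aemeasurable]
  -- Integrating `x` leaves a squared norm in `y`; linearising it makes `y` integrable in turn. Only
  -- a Gaussian vector indexed by `α` remains, so the bound depends on `card α` and not on `ι` or
  -- `κ`.
  calc _ ≤ ∫⁻ y, ENNReal.ofReal (Real.exp (t ^ 2 * (∑ a, ‖(B.vecMul y) a‖ ^ 2) / 2)) ∂ν :=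
        lintegral_mono fun y => hμ.lintegral_exp_le hA t _
    _ = ∫⁻ h, ∫⁻ y, ENNReal.ofReal (Real.exp (t * (B.vecMul y ⬝ᵥ h).re)) ∂ν
          ∂(Measure.pi fun _ : α => complexGaussian 2) := by
        simp_rw [ofReal_exp_norm_sq_eq_lintegral]
        exact lintegral_lintegral_swap m2.aemeasurable
    _ ≤ _ := lintegral_mono fun h => hν.lintegral_exp_le hB t _
    _ ≤ _ := lintegral_exp_sum_norm_sq_le ht

/-! ### Decoupling for one complex Gaussian vector -/

lemma map_I_mul_complexGaussian (v : ℝ≥0) :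
    (complexGaussian v).map (fun z => Complex.I * z) = complexGaussian v := by
  have h1 : MeasurePreserving (fun x : ℝ => -x) (gaussianReal 0 (v / 2)) (gaussianReal 0 (v / 2)) :=
    ⟨by fun_prop, by simp [gaussianReal_map_neg]⟩
  have h2 : MeasurePreserving (fun p : ℝ × ℝ => (-p.2, p.1))
      ((gaussianReal 0 (v / 2)).prod (gaussianReal 0 (v / 2)))
      ((gaussianReal 0 (v / 2)).prod (gaussianReal 0 (v / 2))) :=
    (h1.prod (MeasurePreserving.id _)).comp
      (Measure.measurePreserving_swap (μ := gaussianReal 0 (v / 2)) (ν := gaussianReal 0 (v / 2)))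
  rw [complexGaussian, Measure.map_map (by fun_prop) measurable_complex_mk]
  conv_rhs => rw [← h2.map_eq, Measure.map_map measurable_complex_mk h2.measurable]
  congr 1
  ext p
  apply Complex.ext <;> simp

lemma map_I_smul_pi_complexGaussian (v : ℝ≥0) :
    (Measure.pi fun _ : ι => complexGaussian v).map (fun x => Complex.I • x)
      = Measure.pi fun _ : ι => complexGaussian v := by
  have : ∀ _ : ι, SigmaFinite ((complexGaussian v).map (fun z => Complex.I * z)) := fun _ => by
    rw [map_I_mul_complexGaussian]; infer_instance
  have h := Measure.pi_map_pi (μ := fun _ : ι => complexGaussian v)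
    (f := fun _ z => Complex.I * z) (fun i => by fun_prop)
  simp only [map_I_mul_complexGaussian] at h
  exact h

instance (v : ℝ≥0) : IsGaussian (complexGaussian v) := by
  have h : complexGaussian v = ((gaussianReal 0 (v / 2)).prod (gaussianReal 0 (v / 2))).map
    (Complex.equivRealProdCLM.symm : ℝ × ℝ →L[ℝ] ℂ) := rfl
  rw [h]
  infer_instance

instance (v : ℝ≥0) : IsGaussian (Measure.pi fun _ : ι => complexGaussian v) := by
  have h := iIndepFun.hasGaussianLaw (X := fun i (x : ι → ℂ) => x i)
    (P := Measure.pi fun _ : ι => complexGaussian v)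
    (fun i => ⟨by
      rw [(measurePreserving_eval (fun _ : ι => complexGaussian v) i).map_eq]
      infer_instance⟩)
    (iIndepFun_pi (X := fun _ : ι => id) fun i => aemeasurable_id)
  have h2 := h.isGaussian_map
  have h3 : (fun (ω : ι → ℂ) (i : ι) => ω i) = id := rfl
  rwa [h3, Measure.map_id] at h2

/-- Invariance under multiplication by `I` forces the mean to vanish; rotation invariance of a pair
of copies requires this. -/
lemma integral_id_pi_complexGaussian (v : ℝ≥0) :
    ∫ x, id x ∂(Measure.pi fun _ : ι => complexGaussian v) = 0 := by
  set μ := Measure.pi fun _ : ι => complexGaussian v with hμ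
  have hm : Measurable fun x : ι → ℂ => Complex.I • x := measurable_const_smul _
  have h : ∫ x, id x ∂μ = Complex.I • ∫ x, id x ∂μ := by
    conv_lhs => rw [hμ, ← map_I_smul_pi_complexGaussian, ← hμ]
    rw [integral_map hm.aemeasurable (by fun_prop), ← integral_smul]
    rfl
  have h1 : (1 - Complex.I) • ∫ x, id x ∂μ = 0 := by
    rw [sub_smul, one_smul, ← h, sub_self]
  refine (smul_eq_zero.1 h1).resolve_left fun h0 => ?_
  simpa using congrArg Complex.re h0

lemma lintegral_pi_complexGaussian_rotate (v : ℝ≥0) {f : (ι → ℂ) × (ι → ℂ) → ℝ≥0∞}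
    (hf : Measurable f) :
    let μ := Measure.pi fun _ : ι => complexGaussian v
    ∫⁻ p, f (((√2)⁻¹ : ℝ) • (p.1 + p.2), ((√2)⁻¹ : ℝ) • (p.2 - p.1)) ∂(μ.prod μ)
      = ∫⁻ p, f p ∂(μ.prod μ) := by
  intro μ
  have h := IsGaussian.map_rotation_eq_self (integral_id_pi_complexGaussian (ι := ι) v) (Real.pi / 4)
  conv_rhs => rw [← h, lintegral_map hf (by fun_prop)]
  refine lintegral_congr fun p => ?_
  have hs : √2 / 2 = (√2)⁻¹ := by
    rw [eq_comm, inv_eq_iff_eq_inv, inv_div, eq_div_iff (by positivity)]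
    exact Real.mul_self_sqrt (by norm_num)
  simp only [ContinuousLinearMap.rotation_apply, Real.cos_pi_div_four, Real.sin_pi_div_four, hs,
    smul_add, smul_sub, neg_smul]
  congr 3
  abel

/-- Tangent line of `exp` at `a`: the four increments sum to zero. -/
lemma four_mul_exp_le (a b c d : ℝ) :
    4 * Real.exp a ≤ Real.exp (a - b + c) + Real.exp (a - b - c) + Real.exp (a + b + d)
      + Real.exp (a + b - d) := by
  have h : ∀ x y, Real.exp x * (1 + y) ≤ Real.exp (x + y) := fun x y => by
    rw [Real.exp_add]
    exact mul_le_mul_of_nonneg_left (by linarith [Real.add_one_le_exp y]) (Real.exp_pos _).le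
  have h1 := h a (-b + c)
  have h2 := h a (-b - c)
  have h3 := h a (b + d)
  have h4 := h a (b - d)
  ring_nf at h1 h2 h3 h4 ⊢
  linarith

/-- Exponential moments of the quadratic form `∑ (Aᵀx)_a (Bᵀx)_a` in one complex Gaussian
vector, by comparison with the decoupled form. -/
lemma lintegral_exp_quadratic_le {A B : Matrix ι α ℂ} (hA : IsContraction A)
    (hB : IsContraction B) {t : ℝ} (ht : (2 * t) ^ 2 ≤ 1 / 2) :
    ∫⁻ x, ENNReal.ofReal (Real.exp (t * (A.vecMul x ⬝ᵥ B.vecMul x).re))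
        ∂(Measure.pi fun _ : ι => complexGaussian 1)
      ≤ ENNReal.ofReal (Real.exp (8 * Fintype.card α * t ^ 2)) := by
  set μ := Measure.pi fun _ : ι => complexGaussian 1 with hμ
  have mq : Measurable fun p : (ι → ℂ) × (ι → ℂ) => A.vecMul p.1 ⬝ᵥ B.vecMul p.2 := by
    have : Continuous fun p : (ι → ℂ) × (ι → ℂ) => A.vecMul p.1 ⬝ᵥ B.vecMul p.2 := by fun_prop
    exact this.measurable
  -- Write `q` for the bilinear form. The factor `-2t` is chosen so that after rotation by `π / 4`
  -- the exponent is `t q(x,x) - t q(y,y)` plus terms linear in `y`.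
  set f : (ι → ℂ) × (ι → ℂ) → ℝ≥0∞ := fun p =>
    ENNReal.ofReal (Real.exp ((-(2 * t)) * (A.vecMul p.1 ⬝ᵥ B.vecMul p.2).re)) with hf
  have mf : Measurable f := by fun_prop
  set F : (ι → ℂ) → (ι → ℂ) → ℝ≥0∞ := fun x y =>
    f (((√2)⁻¹ : ℝ) • (x + y), ((√2)⁻¹ : ℝ) • (y - x)) with hF
  have mF : Measurable (Function.uncurry F) := by
    apply mf.comp
    fun_prop
  have hFe : ∀ x y, F x y = ENNReal.ofReal (Real.exp (t * (A.vecMul x ⬝ᵥ B.vecMul x).re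
      - t * (A.vecMul y ⬝ᵥ B.vecMul y).re
      + t * (A.vecMul y ⬝ᵥ B.vecMul x - A.vecMul x ⬝ᵥ B.vecMul y).re)) := by
    intro x y
    simp only [hF, hf]
    congr 2
    have h2 : ((√2)⁻¹ : ℝ) * (√2)⁻¹ = 1 / 2 := by
      rw [← mul_inv, Real.mul_self_sqrt (by norm_num)]; norm_num
    have : (A.vecMul (((√2)⁻¹ : ℝ) • (x + y)) ⬝ᵥ B.vecMul (((√2)⁻¹ : ℝ) • (y - x)))
        = ((1 / 2 : ℝ) : ℂ) * ((A.vecMul x + A.vecMul y) ⬝ᵥ (B.vecMul y - B.vecMul x)) := by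
      rw [← h2, Matrix.smul_vecMul, Matrix.smul_vecMul, Matrix.add_vecMul, Matrix.sub_vecMul,
        smul_dotProduct, dotProduct_smul, smul_smul, Complex.real_smul]
    rw [this, Complex.re_ofReal_mul]
    simp only [add_dotProduct, dotProduct_sub, Complex.add_re, Complex.sub_re]
    ring
  -- Replacing `y` by `I • y` preserves the law, changes the sign of `q(y,y)` and multiplies the
  -- cross terms by `I`. Over the four powers of `I` everything but `t q(x,x)` averages out, and
  -- convexity removes `y`. This symmetry is what real Gaussian vectors lack.
  have mi : MeasurePreserving (fun x : ι → ℂ => Complex.I • x) μ μ :=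
    ⟨measurable_const_smul _, map_I_smul_pi_complexGaussian 1⟩
  have mFx : ∀ x, Measurable (F x) := fun x => mF.of_uncurry_left
  have i1 : ∀ x, ∫⁻ y, F x (Complex.I • y) ∂μ = ∫⁻ y, F x y ∂μ := fun x =>
    mi.lintegral_comp (mFx x)
  have i2 : ∀ x, ∫⁻ y, F x (Complex.I • Complex.I • y) ∂μ = ∫⁻ y, F x y ∂μ := fun x =>
    (mi.comp mi).lintegral_comp (mFx x)
  have i3 : ∀ x, ∫⁻ y, F x (Complex.I • Complex.I • Complex.I • y) ∂μ = ∫⁻ y, F x y ∂μ :=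
    fun x => (mi.comp (mi.comp mi)).lintegral_comp (mFx x)
  have key : ∀ x, 4 * ENNReal.ofReal (Real.exp (t * (A.vecMul x ⬝ᵥ B.vecMul x).re))
      ≤ 4 * ∫⁻ y, F x y ∂μ := by
    intro x
    have e4 : 4 * ∫⁻ y, F x y ∂μ = ∫⁻ y, (F x y + F x (Complex.I • Complex.I • y)
        + F x (Complex.I • y) + F x (Complex.I • Complex.I • Complex.I • y)) ∂μ := by
      have mc : Measurable fun y : ι → ℂ => Complex.I • y := measurable_const_smul _
      have m1 := (mFx x).comp mc
      have m2 := (mFx x).comp (mc.comp mc)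
      have m3 := (mFx x).comp (mc.comp (mc.comp mc))
      simp only [Function.comp_def] at m1 m2 m3
      rw [lintegral_add_right _ m3, lintegral_add_right _ m1, lintegral_add_right _ m2, i1, i2, i3]
      ring
    rw [e4]
    have c4 : 4 * ENNReal.ofReal (Real.exp (t * (A.vecMul x ⬝ᵥ B.vecMul x).re))
      = ∫⁻ _, 4 * ENNReal.ofReal (Real.exp (t * (A.vecMul x ⬝ᵥ B.vecMul x).re)) ∂μ := by simp
    rw [c4]
    refine lintegral_mono fun y => ?_
    simp only [hFe]
    rw [← ENNReal.ofReal_add (Real.exp_pos _).le (Real.exp_pos _).le,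
      ← ENNReal.ofReal_add (by positivity) (Real.exp_pos _).le,
      ← ENNReal.ofReal_add (by positivity) (Real.exp_pos _).le]
    have : (4 : ℝ≥0∞) = ENNReal.ofReal 4 := by norm_num
    rw [this, ← ENNReal.ofReal_mul (by norm_num)]
    apply ENNReal.ofReal_le_ofReal
    refine (four_mul_exp_le _ (t * (A.vecMul y ⬝ᵥ B.vecMul y).re)
      (t * (A.vecMul y ⬝ᵥ B.vecMul x - A.vecMul x ⬝ᵥ B.vecMul y).re)
      (t * (Complex.I * (A.vecMul y ⬝ᵥ B.vecMul x - A.vecMul x ⬝ᵥ B.vecMul y)).re)).trans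
        (le_of_eq ?_)
    simp only [Matrix.smul_vecMul, smul_dotProduct, dotProduct_smul, smul_eq_mul]
    simp only [← mul_assoc, Complex.I_mul_I]
    simp only [neg_mul, one_mul, neg_neg, Complex.add_re, Complex.sub_re, Complex.neg_re, mul_sub, mul_neg, mul_add,
      sub_neg_eq_add]
    ring_nf
  have key' : ∀ x, ENNReal.ofReal (Real.exp (t * (A.vecMul x ⬝ᵥ B.vecMul x).re))
      ≤ ∫⁻ y, F x y ∂μ := fun x => by
    have := key x
    rwa [ENNReal.mul_le_mul_iff_right (by norm_num) (by norm_num)] at this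
  calc _ ≤ ∫⁻ x, ∫⁻ y, F x y ∂μ ∂μ := lintegral_mono key'
    _ = ∫⁻ p, F p.1 p.2 ∂(μ.prod μ) := (lintegral_prod _ mF.aemeasurable).symm
    _ = ∫⁻ p, f p ∂(μ.prod μ) := lintegral_pi_complexGaussian_rotate 1 mf
    _ ≤ _ := subGauss_pi_complexGaussian.lintegral_exp_bilin_le subGauss_pi_complexGaussian hA hB
        (by rwa [neg_sq])
    _ = _ := by
      congr 2
      ring

end Gaussian

open scoped Matrix Matrix.Norms.L2Operator ComplexOrder

/-! ### Half-nets of unit balls -/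

/-- Take a maximal `1`-separated set in the ball of radius `2`, of size at most `5 ^ dim` by a
volume count, and halve it. Real linear forms are then controlled on the ball up to a factor `2`. -/
lemma exists_half_net (E : Type*) [NormedAddCommGroup E] [NormedSpace ℝ E]
    [FiniteDimensional ℝ E] :
    ∃ S : Finset E, (∀ x ∈ S, ‖x‖ ≤ 1) ∧ S.card ≤ 5 ^ Module.finrank ℝ E ∧
      ∀ f : E →ₗ[ℝ] ℝ, ∀ D : ℝ, (∀ x ∈ S, f x ≤ D) → ∀ x, ‖x‖ ≤ 1 → f x ≤ 2 * D := by
  classical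
  have hprop : ProperSpace E := FiniteDimensional.proper ℝ E
  let Q : ℕ → Prop := fun m => ∃ S : Finset E, (∀ c ∈ S, ‖c‖ ≤ 2) ∧
    (∀ c ∈ S, ∀ d ∈ S, c ≠ d → 1 ≤ ‖c - d‖) ∧ S.card = m
  have hQ0 : Q 0 := ⟨∅, by simp, by simp, rfl⟩
  have hQb : ∀ m, Q m → m ≤ 5 ^ Module.finrank ℝ E := by
    rintro m ⟨S, h1, h2, rfl⟩
    exact Besicovitch.card_le_of_separated S h1 h2
  obtain ⟨S, hS2, hSsep, hScard⟩ := Nat.findGreatest_spec (P := Q) (Nat.zero_le _) hQ0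
  have hcover : ∀ x : E, ‖x‖ ≤ 2 → ∃ s ∈ S, ‖x - s‖ ≤ 1 := by
    intro x hx
    by_contra! hcon
    have hxS : x ∉ S := fun h => by
      have := hcon x h
      simp at this
      linarith
    have hQ' : Q (S.card + 1) := by
      refine ⟨insert x S, ?_, ?_, Finset.card_insert_of_notMem hxS⟩
      · intro c hc
        rcases Finset.mem_insert.1 hc with rfl | hc
        exacts [hx, hS2 c hc]
      · intro c hc d hd hcd
        rcases Finset.mem_insert.1 hc with hc' | hc' <;>
          rcases Finset.mem_insert.1 hd with hd' | hd'
        · exact absurd (hc'.trans hd'.symm) hcd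
        · rw [hc']; exact (hcon d hd').le
        · rw [hd', norm_sub_rev]; exact (hcon c hc').le
        · exact hSsep c hc' d hd' hcd
    have h1 := Nat.le_findGreatest (hQb _ hQ') hQ'
    rw [hScard] at h1
    exact Nat.not_succ_le_self _ h1
  refine ⟨S.image fun s => (1 / 2 : ℝ) • s, ?_, ?_, ?_⟩
  · intro x hx
    obtain ⟨s, hs, rfl⟩ := Finset.mem_image.1 hx
    rw [norm_smul]
    have := hS2 s hs
    norm_num
    linarith
  · exact Finset.card_image_le.trans (Besicovitch.card_le_of_separated S hS2 hSsep)
  · intro f D hD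
    -- If `f` is maximal on the ball at `x₀` and `s` is within `1` of `2 x₀`, then `f (2 x₀ - s) ≤ f
    -- x₀`, so `f x₀ ≤ f s = 2 f (s / 2) ≤ 2 D`.
    obtain ⟨x₀, hx₀, hmax⟩ := (isCompact_closedBall (0 : E) 1).exists_isMaxOn
      ⟨0, by simp⟩ (LinearMap.continuous_of_finiteDimensional f).continuousOn
    have hmax' : ∀ x, ‖x‖ ≤ 1 → f x ≤ f x₀ := fun x hx => hmax (by simpa using hx)
    have hx₀' : ‖x₀‖ ≤ 1 := by simpa using hx₀
    obtain ⟨s, hs, hxs⟩ := hcover ((2 : ℝ) • x₀) (by rw [norm_smul]; norm_num; linarith)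
    have h1 := hD _ (Finset.mem_image_of_mem _ hs)
    have h2 := hmax' _ hxs
    simp only [map_smul, map_sub, smul_eq_mul] at h1 h2
    intro x hx
    have := hmax' x hx
    linarith

/-! ### Contractions -/

section Contraction

variable {m n α β : Type*} [Fintype m] [Fintype n] [Fintype α] [Fintype β]

lemma isContraction_of_norm_le_one [DecidableEq α] {A : Matrix m α ℂ} (hA : ‖A‖ ≤ 1) : IsContraction A := by
  intro h
  have h1 := Matrix.l2_opNorm_mulVec A (WithLp.toLp 2 h)
  have h2 : ‖(EuclideanSpace.equiv m ℂ).symm (A *ᵥ h)‖ ≤ ‖(WithLp.toLp 2 h : EuclideanSpace ℂ α)‖ :=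
    h1.trans (mul_le_of_le_one_left (norm_nonneg _) hA)
  have h3 := pow_le_pow_left₀ (norm_nonneg _) h2 2
  rw [EuclideanSpace.norm_sq_eq, EuclideanSpace.norm_sq_eq] at h3
  exact h3

lemma IsContraction.kronecker {A : Matrix m α ℂ} {B : Matrix n β ℂ} (hA : IsContraction A)
    (hB : IsContraction B) : IsContraction (A ⊗ₖ B) := by
  intro h
  have e : ∀ p : m × n, ((A ⊗ₖ B) *ᵥ h) p
      = (A *ᵥ fun a => (B *ᵥ fun b => h (a, b)) p.2) p.1 := by
    intro p
    simp only [Matrix.mulVec, dotProduct, Fintype.sum_prod_type, Matrix.kroneckerMap_apply,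
      Finset.mul_sum, mul_assoc]
  simp only [e]
  rw [Fintype.sum_prod_type_right]
  calc _ ≤ ∑ j, ∑ a, ‖(B *ᵥ fun b => h (a, b)) j‖ ^ 2 := Finset.sum_le_sum fun j _ => hA _
    _ = ∑ a, ∑ j, ‖(B *ᵥ fun b => h (a, b)) j‖ ^ 2 := Finset.sum_comm
    _ ≤ ∑ a, ∑ b, ‖h (a, b)‖ ^ 2 := Finset.sum_le_sum fun a _ => hB _
    _ = _ := (Fintype.sum_prod_type fun p : α × β => ‖h p‖ ^ 2).symm

lemma IsContraction.map_star {A : Matrix m α ℂ} (hA : IsContraction A) :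
    IsContraction (A.map star) := by
  intro h
  have e : ∀ i, ((A.map star) *ᵥ h) i = star ((A *ᵥ star h) i) := by
    intro i
    simp [Matrix.mulVec, dotProduct]
  have := hA (star h)
  simp only [e, norm_star, Pi.star_apply] at this ⊢
  exact this

variable [DecidableEq n] [DecidableEq α]

lemma norm_le_of_conjTranspose_mul_self_eq_diagonal {A : Matrix m α ℂ} {d : α → ℝ} {s : ℝ}
    (hs : 0 ≤ s) (h : Aᴴ * A = Matrix.diagonal fun a => (d a : ℂ)) (h0 : ∀ a, 0 ≤ d a)
    (h1 : ∀ a, d a ≤ s ^ 2) : ‖A‖ ≤ s := by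
  have h2 := Matrix.l2_opNorm_conjTranspose_mul_self A
  rw [h, Matrix.l2_opNorm_diagonal] at h2
  have h3 : ‖fun a => (d a : ℂ)‖ ≤ s ^ 2 := by
    rw [pi_norm_le_iff_of_nonneg (by positivity)]
    intro a
    rw [Complex.norm_real, Real.norm_of_nonneg (h0 a)]
    exact h1 a
  rw [h2, ← sq] at h3
  exact le_of_sq_le_sq h3 hs

/-- Padding by zero columns. -/
lemma exists_padding {A B : Matrix m α ℂ} (hA : ‖A‖ ≤ 1) (hB : ‖B‖ ≤ 1) {r : ℕ}
    (hr : Fintype.card α ≤ r) :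
    ∃ A' B' : Matrix m (Fin r) ℂ, ‖A'‖ ≤ 1 ∧ ‖B'‖ ≤ 1 ∧ A' * B'ᴴ = A * Bᴴ := by
  obtain ⟨f⟩ : Nonempty (α ↪ Fin r) := Function.Embedding.nonempty_of_card_le (by simpa using hr)
  let P : Matrix α (Fin r) ℂ := Matrix.of fun a b => if f a = b then 1 else 0
  have hP : P * Pᴴ = 1 := by
    ext a b
    simp [P, Matrix.mul_apply, Matrix.one_apply, f.injective.eq_iff, apply_ite, eq_comm]
  have hPn : ‖P‖ ≤ 1 := by
    rw [← Matrix.l2_opNorm_conjTranspose]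
    apply norm_le_of_conjTranspose_mul_self_eq_diagonal (d := fun _ => 1) zero_le_one
    · rw [Matrix.conjTranspose_conjTranspose, hP]
      simp
    · simp
    · simp
  refine ⟨A * P, B * P, ?_, ?_, ?_⟩
  · exact (Matrix.l2_opNorm_mul A P).trans (mul_le_one₀ hA (norm_nonneg _) hPn)
  · exact (Matrix.l2_opNorm_mul B P).trans (mul_le_one₀ hB (norm_nonneg _) hPn)
  · rw [Matrix.conjTranspose_mul, Matrix.mul_assoc, ← Matrix.mul_assoc P, hP, Matrix.one_mul]

/-- The columns of `φ` become orthogonal after a unitary change of basis. -/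
lemma exists_unitary_orthogonal_columns (φ : Matrix m n ℂ) :
    ∃ (V : Matrix n n ℂ) (pos : n ≃ Fin (Fintype.card n)) (μ : Fin (Fintype.card n) → ℝ),
      Antitone μ ∧ (∀ k, 0 ≤ μ k) ∧ V * Vᴴ = 1 ∧ Vᴴ * V = 1 ∧
      (φ * V)ᴴ * (φ * V) = Matrix.diagonal fun k => (μ (pos k) : ℂ) := by
  have hH : (φᴴ * φ).IsHermitian := Matrix.isHermitian_conjTranspose_mul_self φ
  have hps := Matrix.posSemidef_conjTranspose_mul_self φ
  let U := hH.eigenvectorUnitary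
  have h1 : (U : Matrix n n ℂ) * (U : Matrix n n ℂ)ᴴ = 1 := Unitary.mul_star_self_of_mem U.2
  have h2 : (U : Matrix n n ℂ)ᴴ * (U : Matrix n n ℂ) = 1 := Unitary.star_mul_self_of_mem U.2
  refine ⟨U, (Fintype.equivOfCardEq (Fintype.card_fin _)).symm, hH.eigenvalues₀,
    hH.eigenvalues₀_antitone, ?_, h1, h2, ?_⟩
  · intro k
    have := hps.eigenvalues_nonneg ((Fintype.equivOfCardEq (Fintype.card_fin _)) k)
    simpa [Matrix.IsHermitian.eigenvalues] using this
  · have h := hH.conjStarAlgAut_star_eigenvectorUnitary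
    rw [Unitary.conjStarAlgAut_star_apply] at h
    rw [Matrix.conjTranspose_mul, Matrix.mul_assoc, ← Matrix.mul_assoc φᴴ, ← Matrix.mul_assoc]
    exact h

end Contraction

/-! ### The trilinear form attached to two three-dimensional arrays -/

section Trip

variable {n : Type*} [Fintype n] {α β γ : Type*} [Fintype α] [Fintype β] [Fintype γ]

/-- The trilinear form `∑ x_{ikl} y_{i'k'l'} φ_{ii'} ψ_{kk'} χ_{ll'}`. -/
def trip (x y : n × n × n → ℂ) (φ ψ χ : Matrix n n ℂ) : ℂ :=
  x ⬝ᵥ (φ ⊗ₖ (ψ ⊗ₖ χ)) *ᵥ y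

lemma trip_eq_sum (x y : n × n × n → ℂ) (φ ψ χ : Matrix n n ℂ) :
    trip x y φ ψ χ = ∑ p, ∑ q, x p * y q * (φ p.1 q.1 * (ψ p.2.1 q.2.1 * χ p.2.2 q.2.2)) := by
  simp only [trip, dotProduct, Matrix.mulVec, Matrix.kroneckerMap_apply, Finset.mul_sum]
  refine Finset.sum_congr rfl fun p _ => Finset.sum_congr rfl fun q _ => ?_
  ring

lemma trip_add_left (x y : n × n × n → ℂ) (φ φ' ψ χ : Matrix n n ℂ) :
    trip x y (φ + φ') ψ χ = trip x y φ ψ χ + trip x y φ' ψ χ := by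
  simp only [trip, Matrix.add_kronecker, Matrix.add_mulVec, dotProduct_add]

lemma trip_smul_left (x y : n × n × n → ℂ) (c : ℂ) (φ ψ χ : Matrix n n ℂ) :
    trip x y (c • φ) ψ χ = c * trip x y φ ψ χ := by
  simp only [trip, Matrix.smul_kronecker, Matrix.smul_mulVec, dotProduct_smul, smul_eq_mul]

/-- The trilinear form as a linear form of its first matrix. -/
def tripLeft (x y : n × n × n → ℂ) (ψ χ : Matrix n n ℂ) : Matrix n n ℂ →ₗ[ℂ] ℂ where
  toFun φ := trip x y φ ψ χ
  map_add' φ φ' := trip_add_left x y φ φ' ψ χ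
  map_smul' c φ := trip_smul_left x y c φ ψ χ

/-- Exchange of the first two coordinates. -/
def swap₁₂ : n × n × n ≃ n × n × n where
  toFun p := (p.2.1, p.1, p.2.2)
  invFun p := (p.2.1, p.1, p.2.2)
  left_inv _ := rfl
  right_inv _ := rfl

/-- Exchange of the first and the last coordinate. -/
def swap₁₃ : n × n × n ≃ n × n × n where
  toFun p := (p.2.2, p.2.1, p.1)
  invFun p := (p.2.2, p.2.1, p.1)
  left_inv _ := rfl
  right_inv _ := rfl

lemma trip_swap₁₂ (x y : n × n × n → ℂ) (φ ψ χ : Matrix n n ℂ) :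
    trip (x ∘ swap₁₂) (y ∘ swap₁₂) ψ φ χ = trip x y φ ψ χ := by
  simp only [trip_eq_sum]
  rw [← (swap₁₂ (n := n)).sum_comp]
  refine Finset.sum_congr rfl fun p _ => ?_
  rw [← (swap₁₂ (n := n)).sum_comp]
  refine Finset.sum_congr rfl fun q _ => ?_
  simp only [swap₁₂, Equiv.coe_fn_mk, Function.comp_apply, Prod.mk.eta]
  ring

lemma trip_swap₁₃ (x y : n × n × n → ℂ) (φ ψ χ : Matrix n n ℂ) :
    trip (x ∘ swap₁₃) (y ∘ swap₁₃) χ ψ φ = trip x y φ ψ χ := by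
  simp only [trip_eq_sum]
  rw [← (swap₁₃ (n := n)).sum_comp]
  refine Finset.sum_congr rfl fun p _ => ?_
  rw [← (swap₁₃ (n := n)).sum_comp]
  refine Finset.sum_congr rfl fun q _ => ?_
  simp only [swap₁₃, Equiv.coe_fn_mk, Function.comp_apply, Prod.mk.eta]
  ring

/-- The form factors through a space whose dimension is the product of the inner dimensions; this
product is the `card α` of the exponential moments. The pairing is bilinear, hence the entrywise
conjugate on the right. -/
lemma trip_mul_conjTranspose (x y : n × n × n → ℂ) (A A' : Matrix n α ℂ) (B B' : Matrix n β ℂ)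
    (C C' : Matrix n γ ℂ) :
    trip x y (A * A'ᴴ) (B * B'ᴴ) (C * C'ᴴ)
      = (A ⊗ₖ (B ⊗ₖ C)).vecMul x ⬝ᵥ ((A' ⊗ₖ (B' ⊗ₖ C')).map star).vecMul y := by
  rw [trip, Matrix.mul_kronecker_mul, Matrix.mul_kronecker_mul, ← Matrix.mulVec_mulVec,
    Matrix.dotProduct_mulVec, ← Matrix.conjTranspose_kronecker, ← Matrix.conjTranspose_kronecker]
  congr 1
  rw [Matrix.conjTranspose, Matrix.transpose_map, Matrix.mulVec_transpose]

lemma trip_eq_trace (x y : n × n × n → ℂ) (φ ψ χ : Matrix n n ℂ) :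
    trip x y φ ψ χ = ((Matrix.of fun i q => x (i, q))ᵀ * φ * (Matrix.of fun i q => y (i, q))
      * (ψ ⊗ₖ χ)ᵀ).trace := by
  rw [trip_eq_sum]
  simp only [Matrix.trace, Matrix.diag_apply, Matrix.mul_apply, Matrix.transpose_apply,
    Matrix.of_apply, Matrix.kroneckerMap_apply, Finset.sum_mul]
  have split : ∀ f : n × n × n → ℂ, ∑ p, f p = ∑ q, ∑ i, f (i, q) := fun f =>
    Fintype.sum_prod_type_right f
  rw [split]
  refine Finset.sum_congr rfl fun q _ => ?_
  simp only [split]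
  rw [Finset.sum_comm]
  refine Finset.sum_congr rfl fun q' _ => ?_
  rw [Finset.sum_comm]
  refine Finset.sum_congr rfl fun i _ => Finset.sum_congr rfl fun i' _ => ?_
  ring

/-- With two factored arguments the trilinear form is a trace `tr (Xᴴ φ Y)`, where the number of
columns of `X` is the product of the inner dimensions. -/
lemma exists_trip_eq_trace (x y : n × n × n → ℂ) (B B' : Matrix n β ℂ) (C C' : Matrix n γ ℂ) :
    ∃ X Y : Matrix n (β × γ) ℂ, ∀ φ,
      trip x y φ (B * B'ᴴ) (C * C'ᴴ) = (Xᴴ * φ * Y).trace := by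
  refine ⟨((Matrix.of fun i q => x (i, q)) * (B ⊗ₖ C)).map star,
    (Matrix.of fun i q => y (i, q)) * (B'ᴴ ⊗ₖ C'ᴴ)ᵀ, fun φ => ?_⟩
  have h : (((Matrix.of fun i q => x (i, q)) * (B ⊗ₖ C)).map star)ᴴ
      = (B ⊗ₖ C)ᵀ * (Matrix.of fun i q => x (i, q))ᵀ := by
    rw [← Matrix.transpose_mul]
    ext
    exact star_star _
  rw [trip_eq_trace, Matrix.mul_kronecker_mul, Matrix.transpose_mul, h, ← Matrix.mul_assoc,
    Matrix.trace_mul_comm]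
  simp only [Matrix.mul_assoc]

variable [DecidableEq α]

/-- A contraction that fixes the range of a matrix and has the same number of columns. -/
lemma exists_range_projection (X : Matrix n α ℂ) :
    ∃ Q : Matrix n α ℂ, ‖Q‖ ≤ 1 ∧ Q * Qᴴ * X = X := by
  obtain ⟨V, pos, μ, -, hμ, h1, -, h3⟩ := exists_unitary_orthogonal_columns X
  set W := X * V with hW
  set d : α → ℝ := fun k => μ (pos k) with hd
  have hd0 : ∀ k, 0 ≤ d k := fun k => hμ _
  -- Since `(√0)⁻¹ = 0`, the null columns of `W` are dropped. Thus `W * S` is a partial isometry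
  -- with the range of `X`.
  set S : Matrix α α ℂ := Matrix.diagonal fun k => (((√(d k))⁻¹ : ℝ) : ℂ) with hS
  have hSS : Sᴴ = S := by
    rw [hS, Matrix.diagonal_conjTranspose]
    congr 1
    ext k
    simp
  have hcol : ∀ k, d k = 0 → ∀ i, W i k = 0 := by
    intro k hk i
    have h := congrFun (congrFun h3 k) k
    rw [Matrix.diagonal_apply_eq, Matrix.mul_apply] at h
    have h' : μ (pos k) = 0 := hk
    rw [h'] at h
    have h4 : ∑ j, ‖W j k‖ ^ 2 = 0 := by
      have := congrArg Complex.re h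
      simp only [Matrix.conjTranspose_apply, Complex.star_def, Complex.conj_mul',
        Complex.re_sum] at this
      simpa [← Complex.ofReal_pow] using this
    have := (Finset.sum_eq_zero_iff_of_nonneg fun j _ => by positivity).1 h4 i (Finset.mem_univ _)
    simpa using this
  have hWd : W * Matrix.diagonal (fun k => ((if d k = 0 then 0 else 1 : ℝ) : ℂ)) = W := by
    ext i k
    rw [Matrix.mul_diagonal]
    by_cases hk : d k = 0
    · simp [hk, hcol k hk i]
    · simp [hk]
  refine ⟨W * S, ?_, ?_⟩
  · refine norm_le_of_conjTranspose_mul_self_eq_diagonal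
      (d := fun k => if d k = 0 then 0 else 1) zero_le_one ?_ ?_ ?_
    · rw [Matrix.conjTranspose_mul, Matrix.mul_assoc, ← Matrix.mul_assoc Wᴴ, h3, hSS, hS,
        Matrix.diagonal_mul_diagonal, Matrix.diagonal_mul_diagonal]
      congr 1
      ext k
      by_cases hk : d k = 0
      · simp [hk]
      · have h5 : (√(d k))⁻¹ * (d k * (√(d k))⁻¹) = 1 := by
          have : 0 < d k := lt_of_le_of_ne (hd0 k) (Ne.symm hk)
          have h6 := Real.mul_self_sqrt this.le
          field_simp
          rw [sq, h6]
        simp only [hk, if_false]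
        exact_mod_cast h5
    · intro k; split_ifs <;> norm_num
    · intro k; split_ifs <;> norm_num
  · have hX : X = W * Vᴴ := by rw [hW, Matrix.mul_assoc, h1, Matrix.mul_one]
    have hmain : (W * S) * (W * S)ᴴ * W = W := by
      rw [Matrix.conjTranspose_mul, Matrix.mul_assoc, Matrix.mul_assoc (Sᴴ), h3, hSS, hS,
        Matrix.mul_assoc W, Matrix.diagonal_mul_diagonal, Matrix.diagonal_mul_diagonal]
      conv_rhs => rw [← hWd]
      congr 2
      ext k
      by_cases hk : d k = 0
      · simp [hk]
      · have h5 : (√(d k))⁻¹ * ((√(d k))⁻¹ * d k) = 1 := by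
          have : 0 < d k := lt_of_le_of_ne (hd0 k) (Ne.symm hk)
          have h6 := Real.mul_self_sqrt this.le
          field_simp
          rw [sq, h6]
        simp only [hk, if_false]
        exact_mod_cast h5
    conv_lhs => rw [hX, ← Matrix.mul_assoc, hmain]
    exact hX.symm

variable [DecidableEq n] [DecidableEq β] [DecidableEq γ]

/-- The inner dimension of the first argument can be reduced to the product of the other two. -/
lemma exists_trip_rank_reduction (x y : n × n × n → ℂ) {A A' : Matrix n α ℂ} (hA : ‖A‖ ≤ 1)
    (hA' : ‖A'‖ ≤ 1) (B B' : Matrix n β ℂ) (C C' : Matrix n γ ℂ) {r : ℕ}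
    (hr : Fintype.card β * Fintype.card γ ≤ r) :
    ∃ Q Q' : Matrix n (Fin r) ℂ, ‖Q‖ ≤ 1 ∧ ‖Q'‖ ≤ 1 ∧
      trip x y (A * A'ᴴ) (B * B'ᴴ) (C * C'ᴴ) = trip x y (Q * Q'ᴴ) (B * B'ᴴ) (C * C'ᴴ) := by
  obtain ⟨X, Y, hXY⟩ := exists_trip_eq_trace x y B B' C C'
  obtain ⟨Q, hQ, hQX⟩ := exists_range_projection X
  -- As `Xᴴ = Xᴴ * (Q * Qᴴ)`, the product `A * A'ᴴ` may be replaced by `Q * (A' * Aᴴ * Q)ᴴ`, whose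
  -- factors are contractions with as many columns as `X`.
  have hR : ‖A' * Aᴴ * Q‖ ≤ 1 := by
    refine (Matrix.l2_opNorm_mul _ _).trans (mul_le_one₀ ?_ (norm_nonneg _) hQ)
    refine (Matrix.l2_opNorm_mul _ _).trans (mul_le_one₀ hA' (norm_nonneg _) ?_)
    rwa [Matrix.l2_opNorm_conjTranspose]
  obtain ⟨Q₁, Q₂, h1, h2, h3⟩ := exists_padding hQ hR (by simpa using hr)
  refine ⟨Q₁, Q₂, h1, h2, ?_⟩
  rw [h3, hXY, hXY]
  have hX' : Xᴴ = Xᴴ * (Q * Qᴴ) := by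
    conv_lhs => rw [← hQX]
    simp only [Matrix.conjTranspose_mul, Matrix.conjTranspose_conjTranspose]
  conv_lhs => rw [hX']
  simp only [Matrix.conjTranspose_mul, Matrix.conjTranspose_conjTranspose, Matrix.mul_assoc]

end Trip

/-! ### Decomposition of a matrix into flat pieces -/

lemma exists_norm_le_one_smul_eq {E : Type*} [NormedAddCommGroup E] [NormedSpace ℂ E] {w : E}
    {c : ℝ} (h : ‖w‖ ≤ c) : ∃ a : E, ‖a‖ ≤ 1 ∧ (c : ℂ) • a = w := by
  rcases eq_or_ne c 0 with rfl | hc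
  · exact ⟨0, by simp, by simpa [eq_comm] using h⟩
  · have hc0 : 0 < c := lt_of_le_of_ne ((norm_nonneg _).trans h) hc.symm
    refine ⟨(c : ℂ)⁻¹ • w, ?_, by rw [smul_inv_smul₀ (by exact_mod_cast hc)]⟩
    rw [norm_smul, norm_inv, Complex.norm_real, Real.norm_of_nonneg hc0.le]
    rwa [inv_mul_le_iff₀ hc0, mul_one]

/-- Cauchy condensation for the sequence shifted by one: the first term counts once and the others
twice, whence `3`. -/
lemma sum_two_pow_mul_le {e : ℕ → ℝ} (he : Antitone e) (h0 : ∀ p, 0 ≤ e p) {N : ℕ}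
    (hN : ∀ p, N ≤ p → e p = 0) (L : ℕ) :
    ∑ j ∈ Finset.range L, e (2 ^ j - 1) * 2 ^ j ≤ 3 * ∑ p ∈ Finset.range N, e p := by
  have hs : ∀ s : Finset ℕ, ∑ p ∈ s, e p ≤ ∑ p ∈ Finset.range N, e p := by
    intro s
    rw [← Finset.sum_filter_add_sum_filter_not s (· < N),
      Finset.sum_eq_zero (s := s.filter fun p => ¬ p < N)
        fun p hp => hN p (by simpa using (Finset.mem_filter.1 hp).2), add_zero]
    exact Finset.sum_le_sum_of_subset_of_nonneg
      (fun p hp => Finset.mem_range.2 (Finset.mem_filter.1 hp).2) fun p _ _ => h0 p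
  cases L with
  | zero =>
    have := hs ∅
    simp only [Finset.sum_empty, Finset.range_zero] at this ⊢
    linarith
  | succ n =>
    have h := Finset.sum_condensed_le (f := fun k => e (k - 1))
      (fun m n _ hmn => he (Nat.sub_le_sub_right hmn 1)) n
    simp only [nsmul_eq_mul, Nat.cast_pow, Nat.cast_ofNat] at h
    have h1 : e (1 - 1) ≤ ∑ p ∈ Finset.range N, e p := by
      simpa using hs {0}
    have h2 : ∑ k ∈ Finset.Ico 2 (2 ^ n + 1), e (k - 1) ≤ ∑ p ∈ Finset.range N, e p := by
      have := Finset.sum_image (f := e) (s := Finset.Ico 2 (2 ^ n + 1)) (g := fun k => k - 1)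
        (fun a ha b hb hab => by
          simp only [Finset.coe_Ico, Set.mem_Ico] at ha hb
          simp only at hab
          omega)
      rw [← this]
      exact hs _
    calc _ = ∑ k ∈ Finset.range (n + 1), 2 ^ k * e (2 ^ k - 1) :=
          Finset.sum_congr rfl fun _ _ => mul_comm _ _
      _ ≤ _ := by linarith

lemma trace_conjTranspose_mul_self {m n : Type*} [Fintype m] [Fintype n] (A : Matrix m n ℂ) :
    (Aᴴ * A).trace = ((∑ i, ∑ j, ‖A i j‖ ^ 2 : ℝ) : ℂ) := by
  simp only [Matrix.trace, Matrix.diag_apply, Matrix.mul_apply, Matrix.conjTranspose_apply,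
    Complex.star_def, Complex.conj_mul']
  rw [Finset.sum_comm]
  push_cast
  rfl

/-- A square matrix is a sum of boundedly many flat pieces of ranks `2 ^ j`. -/
lemma exists_flat_decomposition {N : ℕ} (φ : Matrix (Fin N) (Fin N) ℂ) {L : ℕ} (hL : N < 2 ^ L) :
    ∃ (c : ℕ → ℝ) (A B : (j : ℕ) → Matrix (Fin N) (Fin (2 ^ j)) ℂ),
      (∀ j, 0 ≤ c j) ∧ (∀ j, ‖A j‖ ≤ 1) ∧ (∀ j, ‖B j‖ ≤ 1) ∧
      φ = ∑ j ∈ Finset.range L, (c j : ℂ) • (A j * (B j)ᴴ) ∧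
      ∑ j ∈ Finset.range L, c j * √2 ^ j ≤ √(3 * L) * hsNorm φ := by
  obtain ⟨V, pos, μ, hanti, hμ, h1, h2, h3⟩ := exists_unitary_orthogonal_columns φ
  set W := φ * V with hW
  set e : ℕ → ℝ := fun p => if h : p < Fintype.card (Fin N) then μ ⟨p, h⟩ else 0 with he
  have he0 : ∀ p, 0 ≤ e p := fun p => by
    simp only [he]; split_ifs
    exacts [hμ _, le_rfl]
  have hepos : ∀ k, e (pos k) = μ (pos k) := fun k =>
    dif_pos (pos k).2
  have heN : ∀ p, N ≤ p → e p = 0 := fun p hp => by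
    simp [he, hp]
  have heanti : Antitone e := by
    intro p q hpq
    by_cases hq : q < Fintype.card (Fin N)
    · simp only [he, hq, hpq.trans_lt hq, dif_pos]
      exact hanti hpq
    · simp only [he, hq, dif_neg, not_false_iff]
      exact he0 p
  -- Positions start at `0`, so block `j` consists of the `p` with `2 ^ j ≤ p + 1 < 2 ^ (j + 1)`. It
  -- has at most `2 ^ j` elements, and its squared singular values are at most `e (2 ^ j - 1)`.
  let blk : ℕ → Fin N → Prop := fun j k => Nat.log 2 (pos k + 1) = j
  have hWj : ∀ j, ‖W.submatrix id (Subtype.val : {k // blk j k} → Fin N)‖ ≤ √(e (2 ^ j - 1)) := by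
    intro j
    apply norm_le_of_conjTranspose_mul_self_eq_diagonal (d := fun k => μ (pos k.1))
      (Real.sqrt_nonneg _)
    · ext k l
      refine (congrFun (congrFun h3 k.1) l.1).trans ?_
      simp only [Matrix.diagonal_apply, Subtype.ext_iff]
    · exact fun k => hμ _
    · rintro ⟨k, hk⟩
      rw [Real.sq_sqrt (he0 _), ← hepos]
      apply heanti
      have := Nat.pow_log_le_self 2 (x := pos k + 1) (by omega)
      rw [show Nat.log 2 (pos k + 1) = j from hk] at this
      exact Nat.sub_le_of_le_add this
  have hVj : ∀ j, ‖V.submatrix id (Subtype.val : {k // blk j k} → Fin N)‖ ≤ 1 := by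
    intro j
    apply norm_le_of_conjTranspose_mul_self_eq_diagonal (d := fun k => 1) zero_le_one
    · ext k l
      refine (congrFun (congrFun h2 k.1) l.1).trans ?_
      simp only [Matrix.one_apply, Matrix.diagonal_apply, Subtype.ext_iff, Complex.ofReal_one]
    · simp
    · simp
  have hcard : ∀ j, Fintype.card {k // blk j k} ≤ 2 ^ j := by
    intro j
    have : Fintype.card {k // blk j k} ≤ (Finset.Ico (2 ^ j) (2 ^ (j + 1))).card := by
      rw [Fintype.card_subtype]
      refine Finset.card_le_card_of_injOn (fun k => (pos k : ℕ) + 1) ?_ ?_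
      · intro k hk
        have hk' : Nat.log 2 (pos k + 1) = j := by simpa using hk
        rw [Finset.coe_Ico, ← hk']
        exact ⟨Nat.pow_log_le_self 2 (by omega), Nat.lt_pow_succ_log_self (by norm_num) _⟩
      · intro k _ l _ hkl
        exact pos.injective (Fin.ext (by simpa using hkl))
    rw [Nat.card_Ico] at this
    rw [pow_succ] at this
    omega
  have hex : ∀ j, ∃ A B : Matrix (Fin N) (Fin (2 ^ j)) ℂ, ‖A‖ ≤ 1 ∧ ‖B‖ ≤ 1 ∧
      (√(e (2 ^ j - 1)) : ℂ) • (A * Bᴴ)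
        = W.submatrix id (Subtype.val : {k // blk j k} → Fin N)
          * (V.submatrix id (Subtype.val : {k // blk j k} → Fin N))ᴴ := by
    intro j
    obtain ⟨A₀, hA₀, hA₀W⟩ := exists_norm_le_one_smul_eq (hWj j)
    obtain ⟨A, B, hA, hB, hAB⟩ := exists_padding hA₀ (hVj j) (hcard j)
    exact ⟨A, B, hA, hB, by rw [hAB, ← Matrix.smul_mul, hA₀W]⟩
  choose A B hA hB hAB using hex
  refine ⟨fun j => √(e (2 ^ j - 1)), A, B, fun j => Real.sqrt_nonneg _, hA, hB, ?_, ?_⟩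
  · simp only [hAB]
    have hφ : φ = W * Vᴴ := by rw [hW, Matrix.mul_assoc, h1, Matrix.mul_one]
    rw [hφ]
    ext i i'
    simp only [Matrix.sum_apply, Matrix.mul_apply, Matrix.submatrix_apply,
      Matrix.conjTranspose_apply, id]
    rw [← Finset.sum_fiberwise_of_maps_to (t := Finset.range L)
      (g := fun k => Nat.log 2 (pos k + 1))]
    · refine Finset.sum_congr rfl fun j _ => ?_
      exact Finset.sum_subtype _ (by simp [blk]) _
    · intro k _
      have hk : (pos k : ℕ) < N := by simpa using (pos k).2
      exact Finset.mem_range.2 (Nat.log_lt_of_lt_pow (by omega) (by omega))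
  · have hT : ∑ p ∈ Finset.range N, e p = ∑ i, ∑ i', ‖φ i i'‖ ^ 2 := by
      have t1 : (Wᴴ * W).trace = (φᴴ * φ).trace := by
        rw [hW, Matrix.conjTranspose_mul, Matrix.mul_assoc, Matrix.trace_mul_comm,
          Matrix.mul_assoc, Matrix.mul_assoc, h1, Matrix.mul_one]
      rw [h3, trace_conjTranspose_mul_self, Matrix.trace_diagonal] at t1
      rw [← Complex.ofReal_sum] at t1
      rw [← Complex.ofReal_injective t1, pos.sum_comp μ, Finset.sum_range]
      exact Fintype.sum_equiv (finCongr (by simp)) _ _ fun p => by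
        simp [he]
        rfl
    have hc := sum_two_pow_mul_le heanti he0 heN L
    rw [hT] at hc
    -- Cauchy–Schwarz over the `L` blocks: the source of one factor `√(log N)`.
    have hcs := sq_sum_le_card_mul_sum_sq (s := Finset.range L)
      (f := fun j => √(e (2 ^ j - 1)) * √2 ^ j)
    have hsq : ∀ j, (√(e (2 ^ j - 1)) * √2 ^ j) ^ 2 = e (2 ^ j - 1) * 2 ^ j := fun j => by
      rw [mul_pow, Real.sq_sqrt (he0 _), ← pow_mul, mul_comm j 2, pow_mul,
        Real.sq_sqrt (by norm_num)]
    simp only [hsq, Finset.card_range] at hcs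
    have hdef : hsNorm φ = √(∑ i, ∑ i', ‖φ i i'‖ ^ 2) := rfl
    rw [hdef, ← Real.sqrt_mul (by positivity)]
    apply Real.le_sqrt_of_sq_le
    refine hcs.trans ?_
    calc (L : ℝ) * _ ≤ L * (3 * ∑ i, ∑ i', ‖φ i i'‖ ^ 2) := by gcongr
      _ = _ := by ring

/-! ### From flat arguments to arbitrary arguments -/

section Deterministic

variable {N : ℕ}

/-- A bound for the trilinear form on products of flat matrices of ranks `2 ^ i, 2 ^ j, 2 ^ k`. -/
def FlatBound (x y : Fin N × Fin N × Fin N → ℂ) (D : ℝ) (i j k : ℕ) : Prop :=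
  ∀ (A A' : Matrix (Fin N) (Fin (2 ^ i)) ℂ) (B B' : Matrix (Fin N) (Fin (2 ^ j)) ℂ)
    (C C' : Matrix (Fin N) (Fin (2 ^ k)) ℂ), ‖A‖ ≤ 1 → ‖A'‖ ≤ 1 → ‖B‖ ≤ 1 → ‖B'‖ ≤ 1 →
    ‖C‖ ≤ 1 → ‖C'‖ ≤ 1 →
    ‖trip x y (A * A'ᴴ) (B * B'ᴴ) (C * C'ᴴ)‖ ≤ D * √2 ^ (i + j + k)

variable {x y : Fin N × Fin N × Fin N → ℂ} {D : ℝ} {i j k : ℕ}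

lemma FlatBound.swap₁₂ (h : FlatBound (x ∘ swap₁₂) (y ∘ swap₁₂) D j i k) :
    FlatBound x y D i j k := by
  intro A A' B B' C C' hA hA' hB hB' hC hC'
  rw [← trip_swap₁₂, show i + j + k = j + i + k by ring]
  exact h B B' A A' C C' hB hB' hA hA' hC hC'

lemma FlatBound.swap₁₃ (h : FlatBound (x ∘ swap₁₃) (y ∘ swap₁₃) D k j i) :
    FlatBound x y D i j k := by
  intro A A' B B' C C' hA hA' hB hB' hC hC'
  rw [← trip_swap₁₃, show i + j + k = k + j + i by ring]
  exact h C C' B B' A A' hC hC' hB hB' hA hA'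

/-- Rank reduction brings the first inner dimension down to `2 ^ (j + k)`, and the bound allowed
there is no larger than the one allowed at `i`. -/
lemma FlatBound.extend (hD : 0 ≤ D) (h : FlatBound x y D (j + k) j k) (hi : j + k ≤ i) :
    FlatBound x y D i j k := by
  intro A A' B B' C C' hA hA' hB hB' hC hC'
  obtain ⟨Q, Q', hQ, hQ', he⟩ := exists_trip_rank_reduction x y hA hA' B B' C C'
    (r := 2 ^ (j + k)) (by simp [pow_add])
  rw [he]
  refine (h Q Q' B B' C C' hQ hQ' hB hB' hC hC').trans ?_
  have : (1 : ℝ) ≤ √2 := Real.one_le_sqrt.2 (by norm_num)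
  gcongr

/-- When one exponent exceeds the sum of the other two, lowering it to that sum gives a balanced
triple, still below `L`. At most one exponent can be in excess. -/
lemma flatBound_of_balanced (hD : 0 ≤ D) {L : ℕ}
    (H : ∀ i j k, i < L → j < L → k < L → i ≤ j + k → j ≤ i + k → k ≤ i + j →
      FlatBound x y D i j k) (hi : i < L) (hj : j < L) (hk : k < L) : FlatBound x y D i j k := by
  by_cases h1 : j + k < i
  · exact (H (j + k) j k (by omega) hj hk (by omega) (by omega) (by omega)).extend hD h1.le
  by_cases h2 : i + k < j
  · refine FlatBound.swap₁₂ (FlatBound.extend hD ?_ h2.le)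
    exact FlatBound.swap₁₂ (H i (i + k) k (by omega) (by omega) (by omega) (by omega) (by omega)
      (by omega))
  by_cases h3 : j + i < k
  · refine FlatBound.swap₁₃ (FlatBound.extend hD ?_ h3.le)
    exact FlatBound.swap₁₃ (H i j (j + i) (by omega) (by omega) (by omega) (by omega) (by omega)
      (by omega))
  exact H i j k hi hj hk (by omega) (by omega) (by omega)

lemma norm_trip_le_of_flat_left {L : ℕ} (hL : N < 2 ^ L) {M : ℝ} {ψ χ : Matrix (Fin N) (Fin N) ℂ}
    (h : ∀ i < L, ∀ A A' : Matrix (Fin N) (Fin (2 ^ i)) ℂ, ‖A‖ ≤ 1 → ‖A'‖ ≤ 1 →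
      ‖trip x y (A * A'ᴴ) ψ χ‖ ≤ M * √2 ^ i) (hM : 0 ≤ M) (φ : Matrix (Fin N) (Fin N) ℂ) :
    ‖trip x y φ ψ χ‖ ≤ M * (√(3 * L) * hsNorm φ) := by
  obtain ⟨c, A, A', hc, hA, hA', hφ, hsum⟩ := exists_flat_decomposition φ hL
  have e : trip x y φ ψ χ = ∑ i ∈ Finset.range L, (c i : ℂ) * trip x y (A i * (A' i)ᴴ) ψ χ := by
    conv_lhs => rw [hφ]
    change tripLeft x y ψ χ _ = _
    rw [map_sum]
    exact Finset.sum_congr rfl fun i _ => (tripLeft x y ψ χ).map_smul _ _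
  rw [e]
  calc _ ≤ ∑ i ∈ Finset.range L, M * (c i * √2 ^ i) := by
        refine norm_sum_le_of_le _ fun i hi => ?_
        rw [norm_mul, Complex.norm_real, Real.norm_of_nonneg (hc i)]
        have := mul_le_mul_of_nonneg_left
          (h i (Finset.mem_range.1 hi) (A i) (A' i) (hA i) (hA' i)) (hc i)
        linarith
    _ ≤ _ := by
        rw [← Finset.mul_sum]
        gcongr

lemma hsNorm_nonneg (a : Fin N → Fin N → ℂ) : 0 ≤ hsNorm a := Real.sqrt_nonneg _

/-- A bound on balanced flat arguments gives a bound on all arguments. -/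
lemma norm_trip_le_of_balanced (hD : 0 ≤ D) {L : ℕ} (hL : N < 2 ^ L)
    (H : ∀ i j k, i < L → j < L → k < L → i ≤ j + k → j ≤ i + k → k ≤ i + j →
      FlatBound x y D i j k) (φ ψ χ : Matrix (Fin N) (Fin N) ℂ) :
    ‖trip x y φ ψ χ‖ ≤ D * √(3 * L) ^ 3 * (hsNorm φ * hsNorm ψ * hsNorm χ) := by
  have hφ := hsNorm_nonneg φ
  have hψ := hsNorm_nonneg ψ
  -- The arguments are freed one at a time, each at the price of `√(3 * L)` and its Hilbert–Schmidt
  -- norm.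
  have s1 : ∀ j < L, ∀ k < L, ∀ (B B' : Matrix (Fin N) (Fin (2 ^ j)) ℂ)
      (C C' : Matrix (Fin N) (Fin (2 ^ k)) ℂ), ‖B‖ ≤ 1 → ‖B'‖ ≤ 1 → ‖C‖ ≤ 1 → ‖C'‖ ≤ 1 →
      ‖trip x y φ (B * B'ᴴ) (C * C'ᴴ)‖ ≤ D * √2 ^ (j + k) * (√(3 * L) * hsNorm φ) := by
    intro j hj k hk B B' C C' hB hB' hC hC'
    refine norm_trip_le_of_flat_left hL (fun i hi A A' hA hA' => ?_) (by positivity) φ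
    refine (flatBound_of_balanced hD H hi hj hk A A' B B' C C' hA hA' hB hB' hC hC').trans_eq ?_
    ring
  have s2 : ∀ k < L, ∀ (C C' : Matrix (Fin N) (Fin (2 ^ k)) ℂ), ‖C‖ ≤ 1 → ‖C'‖ ≤ 1 →
      ‖trip x y φ ψ (C * C'ᴴ)‖
        ≤ D * √2 ^ k * (√(3 * L) * hsNorm φ) * (√(3 * L) * hsNorm ψ) := by
    intro k hk C C' hC hC'
    rw [← trip_swap₁₂]
    refine norm_trip_le_of_flat_left hL (fun j hj B B' hB hB' => ?_) (by positivity) ψ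
    rw [trip_swap₁₂]
    refine (s1 j hj k hk B B' C C' hB hB' hC hC').trans_eq ?_
    ring
  rw [← trip_swap₁₃]
  refine (norm_trip_le_of_flat_left (M := D * (√(3 * L) * hsNorm φ) * (√(3 * L) * hsNorm ψ))
    hL (fun k hk C C' hC hC' => ?_) (by positivity) χ).trans_eq (by ring)
  rw [trip_swap₁₃]
  refine (s2 k hk C C' hC hC').trans_eq ?_
  ring

/-! ### Passing to finite nets -/

variable (N) in
/-- A finite set of contractions that is a half-net of the unit ball. -/
def net (r : ℕ) : Finset (Matrix (Fin N) (Fin r) ℂ) :=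
  (exists_half_net (Matrix (Fin N) (Fin r) ℂ)).choose

lemma norm_le_one_of_mem_net {r : ℕ} {A : Matrix (Fin N) (Fin r) ℂ} (hA : A ∈ net N r) :
    ‖A‖ ≤ 1 :=
  (exists_half_net (Matrix (Fin N) (Fin r) ℂ)).choose_spec.1 A hA

lemma card_net_le (r : ℕ) : (net N r).card ≤ 5 ^ (2 * N * r) := by
  refine (exists_half_net (Matrix (Fin N) (Fin r) ℂ)).choose_spec.2.1.trans_eq ?_
  rw [Module.finrank_matrix, Complex.finrank_real_complex]
  congr 1
  simp
  ring

lemma le_two_mul_of_net {r : ℕ} (f : Matrix (Fin N) (Fin r) ℂ →ₗ[ℝ] ℝ) (D : ℝ)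
    (h : ∀ A ∈ net N r, f A ≤ D) {A : Matrix (Fin N) (Fin r) ℂ} (hA : ‖A‖ ≤ 1) : f A ≤ 2 * D :=
  (exists_half_net (Matrix (Fin N) (Fin r) ℂ)).choose_spec.2.2 f D h A hA

/-- The real part is real-linear in `A` and, despite the conjugation, in `A'`; each passage to the
net costs a factor `2`. -/
lemma re_le_four_mul_of_net {r : ℕ} (T : Matrix (Fin N) (Fin N) ℂ →ₗ[ℂ] ℂ) (D : ℝ)
    (h : ∀ A ∈ net N r, ∀ A' ∈ net N r, (T (A * A'ᴴ)).re ≤ D)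
    {A A' : Matrix (Fin N) (Fin r) ℂ} (hA : ‖A‖ ≤ 1) (hA' : ‖A'‖ ≤ 1) :
    (T (A * A'ᴴ)).re ≤ 4 * D := by
  let f (A' : Matrix (Fin N) (Fin r) ℂ) : Matrix (Fin N) (Fin r) ℂ →ₗ[ℝ] ℝ :=
    { toFun := fun A => (T (A * A'ᴴ)).re
      map_add' := fun A B => by simp only [Matrix.add_mul, map_add, Complex.add_re]
      map_smul' := fun c A => by
        simp only [Matrix.smul_mul, LinearMap.map_smul_of_tower, Complex.real_smul,
          Complex.re_ofReal_mul, smul_eq_mul, RingHom.id_apply] }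
  let g (A : Matrix (Fin N) (Fin r) ℂ) : Matrix (Fin N) (Fin r) ℂ →ₗ[ℝ] ℝ :=
    { toFun := fun A' => (T (A * A'ᴴ)).re
      map_add' := fun A' B => by
        simp only [Matrix.conjTranspose_add, Matrix.mul_add, map_add, Complex.add_re]
      map_smul' := fun c A' => by
        simp only [Matrix.conjTranspose_smul, star_trivial, Matrix.mul_smul,
          LinearMap.map_smul_of_tower, Complex.real_smul, Complex.re_ofReal_mul, smul_eq_mul,
          RingHom.id_apply] }
  have h1 : ∀ A' ∈ net N r, (T (A * A'ᴴ)).re ≤ 2 * D := fun A' hA' =>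
    le_two_mul_of_net (f A') D (fun A hA => h A hA A' hA') hA
  have h2 := le_two_mul_of_net (g A) (2 * D) h1 hA'
  calc _ ≤ 2 * (2 * D) := h2
    _ = 4 * D := by ring

lemma flatBound_of_net {i j k : ℕ}
    (h : ∀ A ∈ net N (2 ^ i), ∀ A' ∈ net N (2 ^ i), ∀ B ∈ net N (2 ^ j), ∀ B' ∈ net N (2 ^ j),
      ∀ C ∈ net N (2 ^ k), ∀ C' ∈ net N (2 ^ k),
      (trip x y (A * A'ᴴ) (B * B'ᴴ) (C * C'ᴴ)).re ≤ D * √2 ^ (i + j + k)) :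
    FlatBound x y (64 * D) i j k := by
  intro A A' B B' C C' hA hA' hB hB' hC hC'
  have h1 : ∀ (A A' : Matrix (Fin N) (Fin (2 ^ i)) ℂ), ‖A‖ ≤ 1 → ‖A'‖ ≤ 1 →
      ∀ B ∈ net N (2 ^ j), ∀ B' ∈ net N (2 ^ j), ∀ C ∈ net N (2 ^ k), ∀ C' ∈ net N (2 ^ k),
      (trip x y (A * A'ᴴ) (B * B'ᴴ) (C * C'ᴴ)).re ≤ 4 * (D * √2 ^ (i + j + k)) :=
    fun A A' hA hA' B hB B' hB' C hC C' hC' =>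
      re_le_four_mul_of_net (tripLeft x y (B * B'ᴴ) (C * C'ᴴ)) _
        (fun A hA A' hA' => h A hA A' hA' B hB B' hB' C hC C' hC') hA hA'
  have h2 : ∀ (A A' : Matrix (Fin N) (Fin (2 ^ i)) ℂ), ‖A‖ ≤ 1 → ‖A'‖ ≤ 1 →
      ∀ (B B' : Matrix (Fin N) (Fin (2 ^ j)) ℂ), ‖B‖ ≤ 1 → ‖B'‖ ≤ 1 →
      ∀ C ∈ net N (2 ^ k), ∀ C' ∈ net N (2 ^ k),
      (trip x y (A * A'ᴴ) (B * B'ᴴ) (C * C'ᴴ)).re ≤ 4 * (4 * (D * √2 ^ (i + j + k))) := by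
    intro A A' hA hA' B B' hB hB' C hC C' hC'
    rw [← trip_swap₁₂]
    refine re_le_four_mul_of_net (tripLeft (x ∘ swap₁₂) (y ∘ swap₁₂) (A * A'ᴴ) (C * C'ᴴ)) _
      (fun B hB B' hB' => ?_) hB hB'
    change (trip (x ∘ swap₁₂) (y ∘ swap₁₂) (B * B'ᴴ) (A * A'ᴴ) (C * C'ᴴ)).re ≤ _
    rw [trip_swap₁₂]
    exact h1 A A' hA hA' B hB B' hB' C hC C' hC'
  have h3 : ∀ (A A' : Matrix (Fin N) (Fin (2 ^ i)) ℂ), ‖A‖ ≤ 1 → ‖A'‖ ≤ 1 →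
      (trip x y (A * A'ᴴ) (B * B'ᴴ) (C * C'ᴴ)).re ≤ 4 * (4 * (4 * (D * √2 ^ (i + j + k)))) := by
    intro A A' hA hA'
    rw [← trip_swap₁₃]
    refine re_le_four_mul_of_net (tripLeft (x ∘ swap₁₃) (y ∘ swap₁₃) (B * B'ᴴ) (A * A'ᴴ)) _
      (fun C hC C' hC' => ?_) hC hC'
    change (trip (x ∘ swap₁₃) (y ∘ swap₁₃) (C * C'ᴴ) (B * B'ᴴ) (A * A'ᴴ)).re ≤ _
    rw [trip_swap₁₃]
    exact h2 A A' hA hA' B B' hB hB' C hC C' hC'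
  -- A unimodular factor absorbed in `A` turns the real part into the modulus. The total loss is `4
  -- ^ 3 = 64`.
  obtain ⟨u, hu, hu2⟩ := RCLike.exists_norm_eq_mul_self (trip x y (A * A'ᴴ) (B * B'ᴴ) (C * C'ᴴ))
  have h4 := h3 (u • A) A' (by rwa [norm_smul, hu, one_mul]) hA'
  rw [Matrix.smul_mul, trip_smul_left, ← hu2] at h4
  simp only [Complex.coe_algebraMap, Complex.ofReal_re] at h4
  linarith

end Deterministic

/-! ### The union bound -/

section Union

variable {N : ℕ} {Ω : Type*} [MeasurableSpace Ω]

/-- Exponential moments of the trilinear form of two random arrays at flat matrices. -/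
def TripMoment (X Y : Ω → Fin N × Fin N × Fin N → ℂ) (P : Measure Ω) : Prop :=
  ∀ (r s t : ℕ) (A A' : Matrix (Fin N) (Fin r) ℂ) (B B' : Matrix (Fin N) (Fin s) ℂ)
    (C C' : Matrix (Fin N) (Fin t) ℂ), ‖A‖ ≤ 1 → ‖A'‖ ≤ 1 → ‖B‖ ≤ 1 → ‖B'‖ ≤ 1 →
    ‖C‖ ≤ 1 → ‖C'‖ ≤ 1 → ∀ l : ℝ, (2 * l) ^ 2 ≤ 1 / 2 →
    ∫⁻ ω, ENNReal.ofReal (Real.exp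
        (l * (trip (X ω) (Y ω) (A * A'ᴴ) (B * B'ᴴ) (C * C'ᴴ)).re)) ∂P
      ≤ ENNReal.ofReal (Real.exp (8 * (r * s * t) * l ^ 2))

lemma continuous_trip (φ ψ χ : Matrix (Fin N) (Fin N) ℂ) :
    Continuous fun q : (Fin N × Fin N × Fin N → ℂ) × (Fin N × Fin N × Fin N → ℂ) =>
      trip q.1 q.2 φ ψ χ := by
  unfold trip
  fun_prop

lemma aemeasurable_trip {X Y : Ω → Fin N × Fin N × Fin N → ℂ} {P : Measure Ω}
    (hX : AEMeasurable X P) (hY : AEMeasurable Y P) (φ ψ χ : Matrix (Fin N) (Fin N) ℂ) :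
    AEMeasurable (fun ω => trip (X ω) (Y ω) φ ψ χ) P :=
  (continuous_trip φ ψ χ).measurable.comp_aemeasurable (hX.prodMk hY)

variable (N) in
/-- Six-tuples of points of the nets. -/
def netTuples (i j k : ℕ) :=
  (net N (2 ^ i) ×ˢ net N (2 ^ i)) ×ˢ (net N (2 ^ j) ×ˢ net N (2 ^ j)) ×ˢ
    (net N (2 ^ k) ×ˢ net N (2 ^ k))

lemma card_netTuples_le (i j k : ℕ) :
    ((netTuples N i j k).card : ℝ) ≤ Real.exp (24 * N * 2 ^ max i (max j k)) := by
  have h5 : (5 : ℝ) ≤ Real.exp 2 := by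
    have := Real.exp_one_gt_d9
    rw [show (2 : ℝ) = 1 + 1 by norm_num, Real.exp_add]
    nlinarith
  have hnet : ∀ m ≤ max i (max j k),
      ((net N (2 ^ m)).card : ℝ) ≤ Real.exp (4 * N * 2 ^ max i (max j k)) := by
    intro m hm
    calc ((net N (2 ^ m)).card : ℝ) ≤ (5 : ℝ) ^ (2 * N * 2 ^ m) := by
          exact_mod_cast card_net_le (2 ^ m)
      _ ≤ Real.exp 2 ^ (2 * N * 2 ^ m) := by gcongr
      _ = Real.exp (4 * N * 2 ^ m) := by
          rw [← Real.exp_nat_mul]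
          congr 1
          push_cast
          ring
      _ ≤ _ := by
          gcongr
          norm_num
  have e : Real.exp (24 * N * 2 ^ max i (max j k))
      = Real.exp (4 * N * 2 ^ max i (max j k)) ^ 6 := by
    rw [← Real.exp_nat_mul]
    congr 1
    push_cast
    ring
  have hi := hnet i (le_max_left _ _)
  have hj := hnet j ((le_max_left _ _).trans (le_max_right _ _))
  have hk := hnet k ((le_max_right _ _).trans (le_max_right _ _))
  rw [e]
  simp only [netTuples, Finset.card_product, Nat.cast_mul]
  set E := Real.exp (4 * N * 2 ^ max i (max j k))
  calc _ ≤ (E * E) * ((E * E) * (E * E)) := by gcongr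
    _ = _ := by ring

/-- The exponential weight of a point of the net. -/
def netWeight (x y : Fin N × Fin N × Fin N → ℂ) (i j k : ℕ)
    (a : (Matrix (Fin N) (Fin (2 ^ i)) ℂ × Matrix (Fin N) (Fin (2 ^ i)) ℂ) ×
      (Matrix (Fin N) (Fin (2 ^ j)) ℂ × Matrix (Fin N) (Fin (2 ^ j)) ℂ) ×
      (Matrix (Fin N) (Fin (2 ^ k)) ℂ × Matrix (Fin N) (Fin (2 ^ k)) ℂ)) : ℝ :=
  Real.exp (2 ^ max i (max j k) / 4 *
    ((trip x y (a.1.1 * a.1.2ᴴ) (a.2.1.1 * a.2.1.2ᴴ) (a.2.2.1 * a.2.2.2ᴴ)).re / √2 ^ (i + j + k)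
      - 120 * N))

/-- Chernoff bound at `l = ρ / (4 m)`: the threshold `120 N m` contributes `-30 N ρ`, the moment `8
m² l² = ρ² / 2 ≤ N ρ / 2`. The result beats the `exp (24 N ρ)` points of the nets. -/
lemma TripMoment.lintegral_netWeight_le {X Y : Ω → Fin N × Fin N × Fin N → ℂ} {P : Measure Ω}
    (h : TripMoment X Y P) {i j k : ℕ} (hi : i ≤ j + k) (hj : j ≤ i + k) (hk : k ≤ i + j)
    (hmax : 2 ^ max i (max j k) ≤ N) {a} (ha : a ∈ netTuples N i j k) :
    ∫⁻ ω, ENNReal.ofReal (netWeight (X ω) (Y ω) i j k a) ∂P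
      ≤ ENNReal.ofReal (Real.exp (-(28 * N * 2 ^ max i (max j k)))) := by
  simp only [netTuples, Finset.mem_product] at ha
  set ρ : ℝ := 2 ^ max i (max j k) with hρ
  have hρN : ρ ≤ N := by
    rw [hρ]
    exact_mod_cast hmax
  have hρ1 : 0 ≤ ρ := by positivity
  set m : ℝ := √2 ^ (i + j + k) with hm
  have hm0 : 0 < m := by positivity
  have hm2 : m ^ 2 = 2 ^ (i + j + k) := by
    rw [hm, ← pow_mul, mul_comm, pow_mul, Real.sq_sqrt (by norm_num)]
  -- The only use of balance: twice the largest exponent is at most `i + j + k`, which keeps `l` in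
  -- the admissible range.
  have hρm : ρ ^ 2 ≤ m ^ 2 := by
    rw [hm2, hρ, ← pow_mul]
    apply pow_le_pow_right₀ (by norm_num)
    omega
  set l : ℝ := ρ / (4 * m) with hl
  have hl2 : (2 * l) ^ 2 ≤ 1 / 2 := by
    have : (2 * l) ^ 2 = ρ ^ 2 / m ^ 2 / 4 := by
      rw [hl]; field_simp; ring
    have h1 : ρ ^ 2 / m ^ 2 ≤ 1 := div_le_one_of_le₀ hρm (by positivity)
    rw [this]
    linarith
  have hb := h _ _ _ a.1.1 a.1.2 a.2.1.1 a.2.1.2 a.2.2.1 a.2.2.2 (norm_le_one_of_mem_net ha.1.1)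
    (norm_le_one_of_mem_net ha.1.2) (norm_le_one_of_mem_net ha.2.1.1)
    (norm_le_one_of_mem_net ha.2.1.2) (norm_le_one_of_mem_net ha.2.2.1)
    (norm_le_one_of_mem_net ha.2.2.2) l hl2
  have e : ∀ ω, ENNReal.ofReal (netWeight (X ω) (Y ω) i j k a)
      = ENNReal.ofReal (Real.exp (-(30 * N * ρ))) * ENNReal.ofReal (Real.exp (l *
        (trip (X ω) (Y ω) (a.1.1 * a.1.2ᴴ) (a.2.1.1 * a.2.1.2ᴴ) (a.2.2.1 * a.2.2.2ᴴ)).re)) := by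
    intro ω
    rw [← ENNReal.ofReal_mul (Real.exp_pos _).le, ← Real.exp_add, netWeight]
    congr 2
    rw [← hρ, ← hm, hl]
    field_simp
    ring
  simp_rw [e]
  rw [lintegral_const_mul' _ _ ENNReal.ofReal_ne_top]
  refine (mul_le_mul_right hb _).trans ?_
  rw [← ENNReal.ofReal_mul (Real.exp_pos _).le, ← Real.exp_add]
  apply ENNReal.ofReal_le_ofReal
  rw [Real.exp_le_exp]
  have e2 : 8 * (((2 ^ i : ℕ) : ℝ) * ((2 ^ j : ℕ) : ℝ) * ((2 ^ k : ℕ) : ℝ)) * l ^ 2 = ρ ^ 2 / 2 := by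
    have : ((2 ^ i : ℕ) : ℝ) * ((2 ^ j : ℕ) : ℝ) * ((2 ^ k : ℕ) : ℝ) = m ^ 2 := by
      rw [hm2]; push_cast; ring
    rw [this, hl]
    field_simp
    ring
  rw [e2]
  nlinarith

/-- The balanced triples of dyadic ranks. -/
def balanced (L : ℕ) : Finset (ℕ × ℕ × ℕ) :=
  (Finset.range L ×ˢ Finset.range L ×ˢ Finset.range L).filter fun p =>
    p.1 ≤ p.2.1 + p.2.2 ∧ p.2.1 ≤ p.1 + p.2.2 ∧ p.2.2 ≤ p.1 + p.2.1

variable (N) in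
/-- The number of dyadic ranks up to `N`. -/
def levels : ℕ := Nat.log 2 N + 1

/-- The total exponential weight of the nets. -/
def totalWeight (x y : Fin N × Fin N × Fin N → ℂ) : ℝ :=
  ∑ p ∈ balanced (levels N), ∑ a ∈ netTuples N p.1 p.2.1 p.2.2, netWeight x y p.1 p.2.1 p.2.2 a

lemma netWeight_nonneg (x y : Fin N × Fin N × Fin N → ℂ) (i j k : ℕ) (a) :
    0 ≤ netWeight x y i j k a := (Real.exp_pos _).le

lemma totalWeight_nonneg (x y : Fin N × Fin N × Fin N → ℂ) : 0 ≤ totalWeight x y :=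
  Finset.sum_nonneg fun _ _ => Finset.sum_nonneg fun _ _ => netWeight_nonneg _ _ _ _ _ _

lemma aemeasurable_netWeight {X Y : Ω → Fin N × Fin N × Fin N → ℂ} {P : Measure Ω}
    (hX : AEMeasurable X P) (hY : AEMeasurable Y P) (i j k : ℕ) (a) :
    AEMeasurable (fun ω => netWeight (X ω) (Y ω) i j k a) P := by
  have := aemeasurable_trip hX hY (a.1.1 * a.1.2ᴴ) (a.2.1.1 * a.2.1.2ᴴ) (a.2.2.1 * a.2.2.2ᴴ)
  unfold netWeight
  fun_prop

lemma aemeasurable_totalWeight {X Y : Ω → Fin N × Fin N × Fin N → ℂ} {P : Measure Ω}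
    (hX : AEMeasurable X P) (hY : AEMeasurable Y P) :
    AEMeasurable (fun ω => totalWeight (X ω) (Y ω)) P := by
  unfold totalWeight
  exact Finset.aemeasurable_fun_sum _ fun p _ => Finset.aemeasurable_fun_sum _ fun a _ =>
    aemeasurable_netWeight hX hY _ _ _ a

/-- Each balanced triple contributes at most `exp (24 N ρ - 28 N ρ) ≤ exp (-4 N)`, and there are at
most `N ^ 3 ≤ exp (3 N)` of them. -/
lemma TripMoment.lintegral_totalWeight_le {X Y : Ω → Fin N × Fin N × Fin N → ℂ} {P : Measure Ω}
    (h : TripMoment X Y P) (hX : AEMeasurable X P) (hY : AEMeasurable Y P) (hN : 1 ≤ N) :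
    ∫⁻ ω, ENNReal.ofReal (totalWeight (X ω) (Y ω)) ∂P ≤ ENNReal.ofReal (Real.exp (-N)) := by
  have e : ∀ ω, ENNReal.ofReal (totalWeight (X ω) (Y ω)) = ∑ p ∈ balanced (levels N),
      ∑ a ∈ netTuples N p.1 p.2.1 p.2.2,
        ENNReal.ofReal (netWeight (X ω) (Y ω) p.1 p.2.1 p.2.2 a) := by
    intro ω
    rw [totalWeight, ENNReal.ofReal_sum_of_nonneg
      fun p _ => Finset.sum_nonneg fun _ _ => netWeight_nonneg _ _ _ _ _ _]
    exact Finset.sum_congr rfl fun p _ =>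
      ENNReal.ofReal_sum_of_nonneg fun _ _ => netWeight_nonneg _ _ _ _ _ _
  have hm : ∀ (p : ℕ × ℕ × ℕ) (a), AEMeasurable
      (fun ω => ENNReal.ofReal (netWeight (X ω) (Y ω) p.1 p.2.1 p.2.2 a)) P := fun p a =>
    (aemeasurable_netWeight hX hY _ _ _ a).ennreal_ofReal
  simp_rw [e]
  rw [lintegral_finsetSum' _ fun p _ => Finset.aemeasurable_fun_sum _ fun a _ => hm p a]
  have hterm : ∀ p ∈ balanced (levels N), ∫⁻ ω, ∑ a ∈ netTuples N p.1 p.2.1 p.2.2,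
      ENNReal.ofReal (netWeight (X ω) (Y ω) p.1 p.2.1 p.2.2 a) ∂P
        ≤ ENNReal.ofReal (Real.exp (-(4 * N))) := by
    intro p hp
    simp only [balanced, Finset.mem_filter, Finset.mem_product, Finset.mem_range, levels] at hp
    obtain ⟨⟨h1, h2, h3⟩, h4, h5, h6⟩ := hp
    have hmax : 2 ^ max p.1 (max p.2.1 p.2.2) ≤ N :=
      Nat.pow_le_of_le_log (by omega) (by omega)
    rw [lintegral_finsetSum' _ fun a _ => hm p a]
    refine (Finset.sum_le_sum fun a ha => h.lintegral_netWeight_le h4 h5 h6 hmax ha).trans ?_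
    rw [Finset.sum_const, nsmul_eq_mul, ← ENNReal.ofReal_natCast,
      ← ENNReal.ofReal_mul (Nat.cast_nonneg _)]
    apply ENNReal.ofReal_le_ofReal
    refine (mul_le_mul_of_nonneg_right (card_netTuples_le p.1 p.2.1 p.2.2)
      (Real.exp_pos _).le).trans ?_
    rw [← Real.exp_add, Real.exp_le_exp]
    have : (1 : ℝ) ≤ 2 ^ max p.1 (max p.2.1 p.2.2) := one_le_pow₀ (by norm_num)
    have hN' : (0 : ℝ) ≤ N := Nat.cast_nonneg _
    nlinarith
  refine (Finset.sum_le_sum hterm).trans ?_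
  rw [Finset.sum_const, nsmul_eq_mul, ← ENNReal.ofReal_natCast,
    ← ENNReal.ofReal_mul (Nat.cast_nonneg _)]
  apply ENNReal.ofReal_le_ofReal
  have hlev : levels N ≤ N := Nat.log_lt_of_lt_pow (by omega) (Nat.lt_two_pow_self)
  have hcard : (balanced (levels N)).card ≤ N ^ 3 := by
    refine (Finset.card_filter_le _ _).trans ?_
    simp only [Finset.card_product, Finset.card_range]
    calc _ ≤ N * (N * N) := by gcongr
      _ = _ := by ring
  have hNe : (N : ℝ) ≤ Real.exp N := by linarith [Real.add_one_le_exp (N : ℝ)]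
  calc ((balanced (levels N)).card : ℝ) * Real.exp (-(4 * N))
      ≤ (N : ℝ) ^ 3 * Real.exp (-(4 * N)) := by
        gcongr
        exact_mod_cast hcard
    _ ≤ Real.exp N ^ 3 * Real.exp (-(4 * N)) := by gcongr
    _ = Real.exp (-N) := by
        rw [← Real.exp_nat_mul, ← Real.exp_add]
        congr 1
        push_cast
        ring

/-- The trilinear form is controlled by the total weight. -/
lemma norm_trip_le_totalWeight (x y : Fin N × Fin N × Fin N → ℂ)
    (φ ψ χ : Matrix (Fin N) (Fin N) ℂ) :
    ‖trip x y φ ψ χ‖ ≤ 64 * (120 * N + 4 * totalWeight x y) * √(3 * levels N) ^ 3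
      * (hsNorm φ * hsNorm ψ * hsNorm χ) := by
  have hw := totalWeight_nonneg x y
  have hL : N < 2 ^ levels N := Nat.lt_pow_succ_log_self (by norm_num) N
  refine norm_trip_le_of_balanced (by positivity) hL ?_ φ ψ χ
  intro i j k hi hj hk h1 h2 h3
  apply flatBound_of_net
  intro A hA A' hA' B hB B' hB' C hC C' hC'
  have hm0 : 0 < √2 ^ (i + j + k) := by positivity
  rw [← div_le_iff₀ hm0]
  set v := (trip x y (A * A'ᴴ) (B * B'ᴴ) (C * C'ᴴ)).re / √2 ^ (i + j + k) with hv
  have ha : ((A, A'), (B, B'), (C, C')) ∈ netTuples N i j k := by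
    simp only [netTuples, Finset.mem_product]
    exact ⟨⟨hA, hA'⟩, ⟨hB, hB'⟩, hC, hC'⟩
  have hp : (i, j, k) ∈ balanced (levels N) := by
    simp only [balanced, Finset.mem_filter, Finset.mem_product, Finset.mem_range]
    exact ⟨⟨hi, hj, hk⟩, h1, h2, h3⟩
  have hle : netWeight x y i j k ((A, A'), (B, B'), (C, C')) ≤ totalWeight x y :=
    (Finset.single_le_sum (f := netWeight x y i j k)
      (fun a _ => netWeight_nonneg x y i j k a) ha).trans
    (Finset.single_le_sum (f := fun p : ℕ × ℕ × ℕ => ∑ a ∈ netTuples N p.1 p.2.1 p.2.2,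
      netWeight x y p.1 p.2.1 p.2.2 a)
      (fun p _ => Finset.sum_nonneg fun a _ => netWeight_nonneg x y _ _ _ a) hp)
  -- From `u ≤ exp u` and `ρ ≥ 1`, an excess of `v` over `120 N` is at most four times its weight.
  have hexp : 2 ^ max i (max j k) / 4 * (v - 120 * N)
      ≤ netWeight x y i j k ((A, A'), (B, B'), (C, C')) := by
    have := Real.add_one_le_exp ((2 : ℝ) ^ max i (max j k) / 4 * (v - 120 * N))
    simp only [netWeight]
    linarith
  have hρ : (1 : ℝ) ≤ 2 ^ max i (max j k) := one_le_pow₀ (by norm_num)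
  by_contra! hcon
  have h5 : 0 < v - 120 * N := by linarith
  have : (v - 120 * N) / 4 ≤ 2 ^ max i (max j k) / 4 * (v - 120 * N) := by nlinarith
  linarith

end Union

/-! ### Gaussian families -/

section IID

variable {N : ℕ} {Ω : Type*} [MeasurableSpace Ω] {P : Measure Ω}

lemma map_mul_realGaussian (s : ℝ) (v : ℝ≥0) :
    (realGaussian v).map (fun z => (s : ℂ) * z) = realGaussian (NNReal.mk (s ^ 2) (sq_nonneg s) * v) := by
  have h := gaussianReal_map_const_mul (μ := 0) (v := v) s
  rw [mul_zero] at h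
  rw [realGaussian, realGaussian, ← h, Measure.map_map (by fun_prop) (by fun_prop),
    Measure.map_map (by fun_prop) (by fun_prop)]
  congr 1
  ext x
  simp

lemma map_mul_complexGaussian (s : ℝ) (v : ℝ≥0) :
    (complexGaussian v).map (fun z => (s : ℂ) * z)
      = complexGaussian (NNReal.mk (s ^ 2) (sq_nonneg s) * v) := by
  have h := gaussianReal_map_const_mul (μ := 0) (v := v / 2) s
  rw [mul_zero, ← mul_div_assoc] at h
  rw [complexGaussian, complexGaussian, ← h, Measure.map_prod_map _ _ (by fun_prop) (by fun_prop),
    Measure.map_map (by fun_prop) measurable_complex_mk,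
    Measure.map_map measurable_complex_mk (by fun_prop)]
  congr 1
  ext x
  apply Complex.ext <;> simp

/-- Reduces variance `1 / N` to variance `1`. The form is quadratic in the arrays, so undoing the
scaling divides the bound by `N`. -/
lemma IsIID.sqrt_mul {ι : Type*} {X : ι → Ω → ℂ} {γ : ℝ≥0 → Measure ℂ}
    (hγ : γ = realGaussian ∨ γ = complexGaussian) (hN : N ≠ 0)
    (hX : IsIID X (γ (N : ℝ≥0)⁻¹) P) : IsIID (fun i ω => ((√N : ℝ) : ℂ) * X i ω) (γ 1) P := by
  have e : NNReal.mk (√N ^ 2) (sq_nonneg _) * (N : ℝ≥0)⁻¹ = 1 := by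
    have : NNReal.mk (√N ^ 2) (sq_nonneg _) = N := by
      ext
      simp
    rw [this, mul_inv_cancel₀ (by exact_mod_cast hN)]
  have hmap : (γ (N : ℝ≥0)⁻¹).map (fun z => ((√N : ℝ) : ℂ) * z) = γ 1 := by
    rcases hγ with rfl | rfl
    · rw [map_mul_realGaussian, e]
    · rw [map_mul_complexGaussian, e]
  refine ⟨fun i => ⟨?_, ?_⟩, ?_⟩
  · have := (hX.1 i).aemeasurable
    fun_prop
  · rw [← hmap, ← (hX.1 i).map_eq, AEMeasurable.map_map_of_aemeasurable (by fun_prop)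
      (hX.1 i).aemeasurable]
    rfl
  · exact hX.2.comp (fun _ z => ((√N : ℝ) : ℂ) * z) fun _ => by fun_prop

lemma isContraction_kronecker₃ {r s t : ℕ} {A : Matrix (Fin N) (Fin r) ℂ}
    {B : Matrix (Fin N) (Fin s) ℂ} {C : Matrix (Fin N) (Fin t) ℂ} (hA : ‖A‖ ≤ 1) (hB : ‖B‖ ≤ 1)
    (hC : ‖C‖ ≤ 1) : IsContraction (A ⊗ₖ (B ⊗ₖ C)) :=
  (isContraction_of_norm_le_one hA).kronecker
    ((isContraction_of_norm_le_one hB).kronecker (isContraction_of_norm_le_one hC))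

lemma subGauss_pi {ι : Type*} [Fintype ι] {γ : ℝ≥0 → Measure ℂ}
    (hγ : γ = realGaussian ∨ γ = complexGaussian) : SubGauss (Measure.pi fun _ : ι => γ 1) := by
  rcases hγ with rfl | rfl
  exacts [subGauss_pi_realGaussian, subGauss_pi_complexGaussian]

lemma IsIID.hasLaw_prod {ι κ : Type*} [Fintype ι] [Fintype κ] {g : ι → Ω → ℂ} {g' : κ → Ω → ℂ}
    {ν : Measure ℂ} [IsProbabilityMeasure ν] [IsProbabilityMeasure P]
    (h : IsIID (Sum.elim g g') ν P) :
    HasLaw (fun ω => (fun p => g p ω, fun p => g' p ω))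
      ((Measure.pi fun _ : ι => ν).prod (Measure.pi fun _ : κ => ν)) P := by
  have h1 := h.2.hasLaw_pi h.1
  have h2 := measurePreserving_sumPiEquivProdPi (fun _ : ι ⊕ κ => ν)
  refine ⟨?_, ?_⟩
  · exact h2.measurable.comp_aemeasurable h1.aemeasurable
  · rw [← h2.map_eq, ← h1.map_eq, AEMeasurable.map_map_of_aemeasurable
      h2.measurable.aemeasurable h1.aemeasurable]
    rfl

lemma measurable_exp_trip (φ ψ χ : Matrix (Fin N) (Fin N) ℂ) (l : ℝ) :
    Measurable fun q : (Fin N × Fin N × Fin N → ℂ) × (Fin N × Fin N × Fin N → ℂ) =>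
      ENNReal.ofReal (Real.exp (l * (trip q.1 q.2 φ ψ χ).re)) := by
  have := (continuous_trip φ ψ χ).measurable
  fun_prop

lemma IsIID.tripMoment_pair {g g' : Fin N × Fin N × Fin N → Ω → ℂ} [IsProbabilityMeasure P]
    {γ : ℝ≥0 → Measure ℂ} (hγ : γ = realGaussian ∨ γ = complexGaussian)
    (h : IsIID (Sum.elim g g') (γ 1) P) :
    TripMoment (fun ω p => g p ω) (fun ω p => g' p ω) P := by
  have : IsProbabilityMeasure (γ 1) := by
    rcases hγ with rfl | rfl <;> infer_instance
  intro r s t A A' B B' C C' hA hA' hB hB' hC hC' l hl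
  have hlaw := h.hasLaw_prod
  have hm := measurable_exp_trip (A * A'ᴴ) (B * B'ᴴ) (C * C'ᴴ) l
  rw [← lintegral_map' (f := fun q : (Fin N × Fin N × Fin N → ℂ) × (Fin N × Fin N × Fin N → ℂ) =>
    ENNReal.ofReal (Real.exp (l * (trip q.1 q.2 (A * A'ᴴ) (B * B'ᴴ) (C * C'ᴴ)).re)))
    hm.aemeasurable hlaw.aemeasurable, hlaw.map_eq]
  simp only [trip_mul_conjTranspose]
  refine ((subGauss_pi hγ).lintegral_exp_bilin_le (subGauss_pi hγ)
    (isContraction_kronecker₃ hA hB hC) (isContraction_kronecker₃ hA' hB' hC').map_star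
    (by nlinarith)).trans ?_
  apply ENNReal.ofReal_le_ofReal
  simp only [Fintype.card_prod, Fintype.card_fin, Nat.cast_mul, ← mul_assoc]
  gcongr
  norm_num

lemma IsIID.tripMoment_self {g : Fin N × Fin N × Fin N → Ω → ℂ} [IsProbabilityMeasure P]
    (h : IsIID g (complexGaussian 1) P) :
    TripMoment (fun ω p => g p ω) (fun ω p => g p ω) P := by
  intro r s t A A' B B' C C' hA hA' hB hB' hC hC' l hl
  have hlaw := h.2.hasLaw_pi h.1
  have hm := (measurable_exp_trip (A * A'ᴴ) (B * B'ᴴ) (C * C'ᴴ) l).comp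
    (measurable_id.prodMk measurable_id)
  rw [← lintegral_map' (f := fun q : (Fin N × Fin N × Fin N → ℂ) =>
    ENNReal.ofReal (Real.exp (l * (trip q q (A * A'ᴴ) (B * B'ᴴ) (C * C'ᴴ)).re)))
    hm.aemeasurable hlaw.aemeasurable, hlaw.map_eq]
  simp only [trip_mul_conjTranspose]
  refine (lintegral_exp_quadratic_le (isContraction_kronecker₃ hA hB hC)
    (isContraction_kronecker₃ hA' hB' hC').map_star hl).trans_eq ?_
  simp only [Fintype.card_prod, Fintype.card_fin, Nat.cast_mul, ← mul_assoc]

end IID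

/-! ### The two norms in terms of the trilinear form -/

section Norms

variable {N : ℕ}

lemma hsNorm_eq_norm (v : EllTwoSq N) : hsNorm (fun i j => v (i, j)) = ‖v‖ := by
  rw [EuclideanSpace.norm_eq, hsNorm, Fintype.sum_prod_type]

/-- The array of the entries of a family of matrices. -/
def array (Y : Fin N → Matrix (Fin N) (Fin N) ℂ) : Fin N × Fin N × Fin N → ℂ :=
  fun p => Y p.1 p.2.1 p.2.2

lemma dotProduct_sum_kronecker_mulVec (Y Y' : Fin N → Matrix (Fin N) (Fin N) ℂ)
    (a : Fin N → Fin N → ℂ) (ξ η : Fin N × Fin N → ℂ) :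
    ξ ⬝ᵥ (∑ i, ∑ i', a i i' • (Y i ⊗ₖ Y' i')) *ᵥ η
      = trip (array Y) (array Y') (Matrix.of a) (Matrix.of fun k k' => ξ (k, k'))
          (Matrix.of fun l l' => η (l, l')) := by
  rw [trip_eq_sum]
  simp only [Matrix.sum_mulVec, Matrix.smul_mulVec, dotProduct_sum, dotProduct_smul]
  simp only [dotProduct, Matrix.mulVec, Fintype.sum_prod_type, Matrix.kroneckerMap_apply,
    Finset.mul_sum, smul_eq_mul, Matrix.of_apply, array]
  refine Finset.sum_congr rfl fun i _ => ?_
  rw [Finset.sum_comm]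
  refine Finset.sum_congr rfl fun k _ => Eq.symm ?_
  rw [Finset.sum_comm]
  refine Finset.sum_congr rfl fun i' _ => ?_
  rw [Finset.sum_comm]
  refine Finset.sum_congr rfl fun k' _ => Finset.sum_congr rfl fun l _ =>
    Finset.sum_congr rfl fun l' _ => ?_
  ring

/-- With `M` the matrix and `v = M η`, pairing `v` with its own conjugate writes `‖v‖ ^ 2` as a
value of the form, and one factor `‖v‖` cancels. -/
lemma opNorm_le_of_trip {Y Y' : Fin N → Matrix (Fin N) (Fin N) ℂ} {D : ℝ} (hD : 0 ≤ D)
    (h : ∀ φ ψ χ, ‖trip (array Y) (array Y') φ ψ χ‖ ≤ D * (hsNorm φ * hsNorm ψ * hsNorm χ))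
    (a : Fin N → Fin N → ℂ) :
    opNorm (∑ i, ∑ i', a i i' • (Y i ⊗ₖ Y' i')) ≤ D * hsNorm a := by
  have ha := hsNorm_nonneg a
  refine ContinuousLinearMap.opNorm_le_bound _ (by positivity) fun η => ?_
  set M := ∑ i, ∑ i', a i i' • (Y i ⊗ₖ Y' i') with hM
  set v := Matrix.toEuclideanCLM (𝕜 := ℂ) M η with hv
  have hv' : (v : Fin N × Fin N → ℂ) = M *ᵥ η := Matrix.ofLp_toEuclideanCLM M η
  have h1 := h (Matrix.of a) (Matrix.of fun k k' => star (v (k, k')))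
    (Matrix.of fun l l' => η (l, l'))
  have h2 := dotProduct_sum_kronecker_mulVec Y Y' a (star (v : Fin N × Fin N → ℂ)) η
  rw [← hM, ← hv'] at h2
  have h3 : (star (v : Fin N × Fin N → ℂ)) ⬝ᵥ (v : Fin N × Fin N → ℂ) = ((‖v‖ ^ 2 : ℝ) : ℂ) := by
    rw [EuclideanSpace.norm_sq_eq]
    simp only [dotProduct, Pi.star_apply, Complex.star_def, Complex.conj_mul']
    push_cast
    rfl
  have h4 : hsNorm (fun k k' => star (v (k, k'))) = ‖v‖ := by
    rw [← hsNorm_eq_norm]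
    simp only [hsNorm, norm_star]
  have h5 : hsNorm (fun l l' => η (l, l')) = ‖η‖ := hsNorm_eq_norm η
  change _ ≤ D * (hsNorm a * hsNorm (fun k k' => star (v (k, k')))
    * hsNorm (fun l l' => η (l, l'))) at h1
  rw [h4, h5] at h1
  have h6 : ‖v‖ ^ 2 ≤ D * (hsNorm a * ‖v‖ * ‖η‖) := by
    refine le_trans (le_of_eq ?_) h1
    have := congrArg norm (h3.symm.trans h2)
    rw [Complex.norm_real, Real.norm_of_nonneg (sq_nonneg _)] at this
    exact this
  rcases (norm_nonneg v).eq_or_lt with h0 | h0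
  · rw [← h0]
    positivity
  · refine le_of_mul_le_mul_left ?_ h0
    linarith

lemma tripleForm_bigTensor (φ ψ χ : EllTwoSq N →L[ℂ] ℂ) (x y : Fin N × Fin N × Fin N → ℂ) :
    tripleForm φ ψ χ (bigTensor x y) = trip x y (Matrix.of fun i i' => φ (e i i'))
      (Matrix.of fun k k' => ψ (e k k')) (Matrix.of fun l l' => χ (e l l')) := by
  simp only [trip_eq_sum, Fintype.sum_prod_type, bigTensor, map_sum, map_smul, Matrix.of_apply,
    smul_eq_mul, tripleForm, LinearMap.comp_apply, TensorProduct.map_tmul, LinearMap.mul'_apply,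
    ContinuousLinearMap.coe_coe]

lemma hsNorm_dual (φ : EllTwoSq N →L[ℂ] ℂ) : hsNorm (fun i i' => φ (e i i')) = ‖φ‖ := by
  obtain ⟨v, rfl⟩ := (InnerProductSpace.toDual ℂ (EllTwoSq N)).surjective φ
  rw [LinearIsometryEquiv.norm_map, ← hsNorm_eq_norm]
  simp only [hsNorm, InnerProductSpace.toDual_apply_apply, e, EuclideanSpace.inner_single_right,
    one_mul, RCLike.norm_conj]

lemma norm_tripleForm_le {x y : Fin N × Fin N × Fin N → ℂ} {D : ℝ} (hD : 0 ≤ D)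
    (h : ∀ φ ψ χ, ‖trip x y φ ψ χ‖ ≤ D * (hsNorm φ * hsNorm ψ * hsNorm χ))
    {φ ψ χ : EllTwoSq N →L[ℂ] ℂ} (hφ : ‖φ‖ ≤ 1) (hψ : ‖ψ‖ ≤ 1) (hχ : ‖χ‖ ≤ 1) :
    ‖tripleForm φ ψ χ (bigTensor x y)‖ ≤ D := by
  rw [tripleForm_bigTensor]
  refine (h _ _ _).trans ?_
  change D * (hsNorm (fun i i' => φ (e i i')) * hsNorm (fun k k' => ψ (e k k'))
    * hsNorm (fun l l' => χ (e l l'))) ≤ D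
  rw [hsNorm_dual, hsNorm_dual, hsNorm_dual]
  exact mul_le_of_le_one_right hD
    (mul_le_one₀ (mul_le_one₀ hφ (norm_nonneg _) hψ) (norm_nonneg _) hχ)

lemma injectiveNorm_nonneg {E F G : Type*}
    [NormedAddCommGroup E] [NormedSpace ℂ E] [NormedAddCommGroup F] [NormedSpace ℂ F]
    [NormedAddCommGroup G] [NormedSpace ℂ G] (t : E ⊗[ℂ] (F ⊗[ℂ] G)) : 0 ≤ injectiveNorm t := by
  apply Real.sSup_nonneg
  rintro r ⟨φ, ψ, χ, -, -, -, rfl⟩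
  exact norm_nonneg _

lemma injectiveNorm_bigTensor_le {x y : Fin N × Fin N × Fin N → ℂ} {D : ℝ} (hD : 0 ≤ D)
    (h : ∀ φ ψ χ, ‖trip x y φ ψ χ‖ ≤ D * (hsNorm φ * hsNorm ψ * hsNorm χ)) :
    injectiveNorm (bigTensor x y) ≤ D := by
  refine Real.sSup_le ?_ hD
  rintro r ⟨φ, ψ, χ, hφ, hψ, hχ, rfl⟩
  exact norm_tripleForm_le hD h hφ hψ hχ

/-- An uncountable supremum of continuous functions is lower semicontinuous, hence measurable. Its
pointwise finiteness comes from the deterministic bound by `totalWeight`. -/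
lemma measurable_injectiveNorm_bigTensor :
    Measurable fun q : (Fin N × Fin N × Fin N → ℂ) × (Fin N × Fin N × Fin N → ℂ) =>
      injectiveNorm (bigTensor q.1 q.2) := by
  let S := {p : (EllTwoSq N →L[ℂ] ℂ) × (EllTwoSq N →L[ℂ] ℂ) × (EllTwoSq N →L[ℂ] ℂ) //
    ‖p.1‖ ≤ 1 ∧ ‖p.2.1‖ ≤ 1 ∧ ‖p.2.2‖ ≤ 1}
  let f : S → (Fin N × Fin N × Fin N → ℂ) × (Fin N × Fin N × Fin N → ℂ) → ℝ := fun p q =>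
    ‖tripleForm p.1.1 p.1.2.1 p.1.2.2 (bigTensor q.1 q.2)‖
  have hf : ∀ p, Continuous (f p) := fun p => by
    simp only [f, tripleForm_bigTensor]
    exact (continuous_trip _ _ _).norm
  have hbdd : ∀ q, BddAbove (Set.range fun p => f p q) := by
    intro q
    have hw := totalWeight_nonneg q.1 q.2
    refine ⟨64 * (120 * N + 4 * totalWeight q.1 q.2) * √(3 * levels N) ^ 3, ?_⟩
    rintro _ ⟨p, rfl⟩
    exact norm_tripleForm_le (by positivity) (norm_trip_le_totalWeight q.1 q.2)
      p.2.1 p.2.2.1 p.2.2.2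
  have he : (fun q : (Fin N × Fin N × Fin N → ℂ) × (Fin N × Fin N × Fin N → ℂ) =>
      injectiveNorm (bigTensor q.1 q.2)) = fun q => ⨆ p, f p q := by
    ext q
    rw [injectiveNorm, iSup]
    congr 1
    ext r
    constructor
    · rintro ⟨φ, ψ, χ, hφ, hψ, hχ, rfl⟩
      exact ⟨⟨(φ, ψ, χ), hφ, hψ, hχ⟩, rfl⟩
    · rintro ⟨p, rfl⟩
      exact ⟨p.1.1, p.1.2.1, p.1.2.2, p.2.1, p.2.2.1, p.2.2.2, rfl⟩
  rw [he]
  exact (lowerSemicontinuous_ciSup hbdd fun p => (hf p).lowerSemicontinuous).measurable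

end Norms

/-! ### Bounds with high probability and in expectation -/

section Bounds

variable {N : ℕ} {Ω : Type*} [MeasurableSpace Ω] {P : Measure Ω}

/-- For `N ≥ 2`, both `log N / log 2` and `1` are at most `(3 / 2) log N`, so `3 * levels N ≤ 9 log
N`. -/
lemma sqrt_levels_pow_le (hN : 2 ≤ N) :
    √(3 * levels N) ^ 3 ≤ 27 * Real.log N ^ (3 / 2 : ℝ) := by
  have h2 : (2 : ℝ) ≤ N := by exact_mod_cast hN
  have hl2 := Real.log_two_gt_d9
  have hlog : Real.log 2 ≤ Real.log N := Real.log_le_log (by norm_num) h2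
  have h0 : 0 ≤ Real.log N := by linarith
  have h1 : (Nat.log 2 N : ℝ) ≤ Real.log N / Real.log 2 := Real.natLog_le_logb N 2
  have hlev : (levels N : ℝ) ≤ 3 * Real.log N := by
    have h3 : Real.log N / Real.log 2 ≤ 3 / 2 * Real.log N := by
      rw [div_le_iff₀ (by linarith)]
      nlinarith
    rw [levels]
    push_cast
    linarith
  have hle : (3 : ℝ) * levels N ≤ 3 ^ 2 * Real.log N := by linarith
  have e : Real.log N ^ (3 / 2 : ℝ) = √(Real.log N) ^ 3 := by
    rw [Real.sqrt_eq_rpow, ← Real.rpow_natCast, ← Real.rpow_mul h0]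
    norm_num
  calc √(3 * levels N) ^ 3 ≤ √(3 ^ 2 * Real.log N) ^ 3 :=
        pow_le_pow_left₀ (Real.sqrt_nonneg _) (Real.sqrt_le_sqrt hle) 3
    _ = 27 * √(Real.log N) ^ 3 := by
        rw [Real.sqrt_mul (by norm_num), Real.sqrt_sq (by norm_num)]
        ring
    _ = _ := by rw [e]

lemma norm_trip_le_log (hN : 2 ≤ N) (x y : Fin N × Fin N × Fin N → ℂ)
    (φ ψ χ : Matrix (Fin N) (Fin N) ℂ) :
    ‖trip x y φ ψ χ‖ ≤ 1728 * Real.log N ^ (3 / 2 : ℝ) * (120 * N + 4 * totalWeight x y)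
      * (hsNorm φ * hsNorm ψ * hsNorm χ) := by
  have hw := totalWeight_nonneg x y
  have h0 := mul_nonneg (mul_nonneg (hsNorm_nonneg φ) (hsNorm_nonneg ψ)) (hsNorm_nonneg χ)
  refine (norm_trip_le_totalWeight x y φ ψ χ).trans (mul_le_mul_of_nonneg_right ?_ h0)
  calc 64 * (120 * N + 4 * totalWeight x y) * √(3 * levels N) ^ 3
      ≤ 64 * (120 * N + 4 * totalWeight x y) * (27 * Real.log N ^ (3 / 2 : ℝ)) := by
        gcongr
        exact sqrt_levels_pow_le hN
    _ = _ := by ring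

lemma log_rpow_nonneg (hN : 2 ≤ N) : 0 ≤ Real.log N ^ (3 / 2 : ℝ) :=
  Real.rpow_nonneg (Real.log_nonneg (by exact_mod_cast (by omega : 1 ≤ N))) _

/-- The constant is `64 * 27 * 124`, where `120 N + 4 ≤ 124 N`. -/
lemma norm_trip_le_of_totalWeight_le (hN : 2 ≤ N) {x y : Fin N × Fin N × Fin N → ℂ}
    (hw : totalWeight x y ≤ 1) (φ ψ χ : Matrix (Fin N) (Fin N) ℂ) :
    ‖trip x y φ ψ χ‖ ≤ 214272 * Real.log N ^ (3 / 2 : ℝ) * N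
      * (hsNorm φ * hsNorm ψ * hsNorm χ) := by
  have h0 := mul_nonneg (mul_nonneg (hsNorm_nonneg φ) (hsNorm_nonneg ψ)) (hsNorm_nonneg χ)
  have h1 : (1 : ℝ) ≤ N := by exact_mod_cast (by omega : 1 ≤ N)
  have hlog := log_rpow_nonneg hN
  refine (norm_trip_le_log hN x y φ ψ χ).trans (mul_le_mul_of_nonneg_right ?_ h0)
  calc 1728 * Real.log N ^ (3 / 2 : ℝ) * (120 * N + 4 * totalWeight x y)
      ≤ 1728 * Real.log N ^ (3 / 2 : ℝ) * (124 * N) := by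
        gcongr
        linarith
    _ = _ := by ring

lemma TripMoment.measure_lt_totalWeight_le {X Y : Ω → Fin N × Fin N × Fin N → ℂ}
    (h : TripMoment X Y P) (hX : AEMeasurable X P) (hY : AEMeasurable Y P) (hN : 1 ≤ N) :
    P {ω | 1 < totalWeight (X ω) (Y ω)} ≤ ENNReal.ofReal (Real.exp (-N)) := by
  have hm := (aemeasurable_totalWeight hX hY).ennreal_ofReal
  have h1 := mul_meas_ge_le_lintegral₀ hm 1
  rw [one_mul] at h1
  refine (measure_mono fun ω hω => ?_).trans (h1.trans (h.lintegral_totalWeight_le hX hY hN))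
  have : (1 : ℝ) ≤ totalWeight (X ω) (Y ω) := le_of_lt hω
  simpa using ENNReal.ofReal_le_ofReal this

lemma trip_smul_array (s : ℂ) (x y : Fin N × Fin N × Fin N → ℂ)
    (φ ψ χ : Matrix (Fin N) (Fin N) ℂ) :
    trip (s • x) (s • y) φ ψ χ = s ^ 2 * trip x y φ ψ χ := by
  simp only [trip, Matrix.mulVec_smul, dotProduct_smul, smul_dotProduct, smul_eq_mul]
  ring

lemma opNorm_le_of_totalWeight_le (hN : 2 ≤ N) {Y Y' : Fin N → Matrix (Fin N) (Fin N) ℂ}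
    (hw : totalWeight (((√N : ℝ) : ℂ) • array Y) (((√N : ℝ) : ℂ) • array Y') ≤ 1)
    (a : Fin N → Fin N → ℂ) :
    opNorm (∑ i, ∑ i', a i i' • (Y i ⊗ₖ Y' i'))
      ≤ 214272 * Real.log N ^ (3 / 2 : ℝ) * hsNorm a := by
  have hlog := log_rpow_nonneg hN
  refine opNorm_le_of_trip (by positivity) (fun φ ψ χ => ?_) a
  have h := norm_trip_le_of_totalWeight_le hN hw φ ψ χ
  have hN0 : (0 : ℝ) < N := by exact_mod_cast (by omega : 0 < N)
  rw [trip_smul_array, norm_mul, norm_pow, Complex.norm_real, Real.norm_of_nonneg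
    (Real.sqrt_nonneg _), Real.sq_sqrt hN0.le] at h
  refine le_of_mul_le_mul_left ?_ hN0
  linarith

lemma measure_not_opNorm_le (hN : 2 ≤ N) {Y Y' : Fin N → Ω → Matrix (Fin N) (Fin N) ℂ}
    (h : TripMoment (fun ω p => ((√N : ℝ) : ℂ) * entries Y p ω)
      (fun ω p => ((√N : ℝ) : ℂ) * entries Y' p ω) P)
    (hY : AEMeasurable (fun ω p => ((√N : ℝ) : ℂ) * entries Y p ω) P)
    (hY' : AEMeasurable (fun ω p => ((√N : ℝ) : ℂ) * entries Y' p ω) P) :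
    P {ω | ¬ ∀ a : Fin N → Fin N → ℂ, opNorm (∑ i, ∑ i', a i i' • (Y i ω ⊗ₖ Y' i' ω))
      ≤ 214272 * Real.log N ^ (3 / 2 : ℝ) * hsNorm a} ≤ ENNReal.ofReal (Real.exp (-N)) := by
  refine (measure_mono fun ω hω => ?_).trans (h.measure_lt_totalWeight_le hY hY' (by omega))
  by_contra hw
  exact hω fun a => opNorm_le_of_totalWeight_le hN (Y := fun i => Y i ω) (Y' := fun i => Y' i ω)
    (not_lt.1 hw) a

lemma injectiveNorm_bigTensor_le_log (hN : 2 ≤ N) (x y : Fin N × Fin N × Fin N → ℂ) :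
    injectiveNorm (bigTensor x y)
      ≤ 1728 * Real.log N ^ (3 / 2 : ℝ) * (120 * N + 4 * totalWeight x y) := by
  have hw := totalWeight_nonneg x y
  have hlog := log_rpow_nonneg hN
  exact injectiveNorm_bigTensor_le (by positivity) (norm_trip_le_log hN x y)

/-- The bound is affine in `totalWeight`, whose mean is at most `1`, so it can be integrated; the
tail is Markov's inequality for the event `1 < totalWeight`. -/
lemma TripMoment.injectiveNorm_bounds [IsProbabilityMeasure P]
    {X Y : Ω → Fin N × Fin N × Fin N → ℂ} (h : TripMoment X Y P) (hX : AEMeasurable X P)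
    (hY : AEMeasurable Y P) (hN : 2 ≤ N) :
    Integrable (fun ω => injectiveNorm (bigTensor (X ω) (Y ω))) P ∧
      ∫ ω, injectiveNorm (bigTensor (X ω) (Y ω)) ∂P ≤ 214272 * Real.log N ^ (3 / 2 : ℝ) * N ∧
      P {ω | 214272 * Real.log N ^ (3 / 2 : ℝ) * N < injectiveNorm (bigTensor (X ω) (Y ω))}
        ≤ ENNReal.ofReal (Real.exp (-N)) := by
  have hlog := log_rpow_nonneg hN
  have hN1 : (1 : ℝ) ≤ N := by exact_mod_cast (by omega : 1 ≤ N)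
  have hw := h.lintegral_totalWeight_le hX hY (by omega)
  have hwint : Integrable (fun ω => totalWeight (X ω) (Y ω)) P := by
    refine ⟨(aemeasurable_totalWeight hX hY).aestronglyMeasurable, ?_⟩
    rw [hasFiniteIntegral_iff_ofReal (ae_of_all _ fun ω => totalWeight_nonneg _ _)]
    exact hw.trans_lt ENNReal.ofReal_lt_top
  have hwle : ∫ ω, totalWeight (X ω) (Y ω) ∂P ≤ 1 := by
    rw [integral_eq_lintegral_of_nonneg_ae (ae_of_all _ fun ω => totalWeight_nonneg _ _)
      hwint.aestronglyMeasurable]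
    refine ENNReal.toReal_le_of_le_ofReal zero_le_one (hw.trans (ENNReal.ofReal_le_ofReal ?_))
    exact Real.exp_le_one_iff.2 (by linarith)
  have hdom : Integrable (fun ω => 1728 * Real.log N ^ (3 / 2 : ℝ)
      * (120 * N + 4 * totalWeight (X ω) (Y ω))) P :=
    ((integrable_const _).add (hwint.const_mul _)).const_mul _
  have hint : Integrable (fun ω => injectiveNorm (bigTensor (X ω) (Y ω))) P := by
    refine hdom.mono'
      (measurable_injectiveNorm_bigTensor.comp_aemeasurable (hX.prodMk hY)).aestronglyMeasurable
      (ae_of_all _ fun ω => ?_)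
    rw [Real.norm_of_nonneg (injectiveNorm_nonneg _)]
    exact injectiveNorm_bigTensor_le_log hN _ _
  refine ⟨hint, ?_, ?_⟩
  · calc _ ≤ ∫ ω, 1728 * Real.log N ^ (3 / 2 : ℝ)
          * (120 * N + 4 * totalWeight (X ω) (Y ω)) ∂P :=
          integral_mono hint hdom fun ω => injectiveNorm_bigTensor_le_log hN _ _
      _ = 1728 * Real.log N ^ (3 / 2 : ℝ)
          * (120 * N + 4 * ∫ ω, totalWeight (X ω) (Y ω) ∂P) := by
          rw [integral_const_mul, integral_add (integrable_const _) (hwint.const_mul _)]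
          simp [integral_const_mul]
      _ ≤ 1728 * Real.log N ^ (3 / 2 : ℝ) * (124 * N) := by
          gcongr
          linarith
      _ = _ := by ring
  · refine (measure_mono fun ω hω => ?_).trans (h.measure_lt_totalWeight_le hX hY (by omega))
    by_contra hcon
    have := injectiveNorm_bigTensor_le (by positivity)
      (norm_trip_le_of_totalWeight_le hN (not_lt.1 hcon))
    exact absurd hω (not_lt.2 this)

end Bounds

end GaussTensor

end

/-! ### The main theorem. -/

theorem theorem1 :
    ∃ C c : ℝ, 0 < C ∧ 0 < c ∧
      ∀ (N : ℕ), 2 ≤ N → ∀ (Ω : Type*) [MeasurableSpace Ω] (P : Measure Ω)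
        [IsProbabilityMeasure P],
        -- one sequence of complex Gaussian matrices
        (∀ Y : Fin N → Ω → Matrix (Fin N) (Fin N) ℂ,
          GaussTensor.IsIID (GaussTensor.entries Y)
            (GaussTensor.complexGaussian (N : ℝ≥0)⁻¹) P →
          P {ω | ¬ ∀ a : Fin N → Fin N → ℂ,
              GaussTensor.opNorm (∑ i, ∑ i', a i i' • (Y i ω ⊗ₖ Y i' ω))
                ≤ C * Real.log N ^ (3 / 2 : ℝ) * GaussTensor.hsNorm a}
            ≤ ENNReal.ofReal (Real.exp (-(c * N)))) ∧
        -- two independent sequences, real or complex Gaussian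
        (∀ γ : ℝ≥0 → Measure ℂ,
          (γ = GaussTensor.realGaussian ∨ γ = GaussTensor.complexGaussian) →
          (∀ Y Y' : Fin N → Ω → Matrix (Fin N) (Fin N) ℂ,
            GaussTensor.IsIID (Sum.elim (GaussTensor.entries Y) (GaussTensor.entries Y'))
              (γ (N : ℝ≥0)⁻¹) P →
            P {ω | ¬ ∀ a : Fin N → Fin N → ℂ,
                GaussTensor.opNorm (∑ i, ∑ i', a i i' • (Y i ω ⊗ₖ Y' i' ω))
                  ≤ C * Real.log N ^ (3 / 2 : ℝ) * GaussTensor.hsNorm a}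
              ≤ ENNReal.ofReal (Real.exp (-(c * N)))) ∧
          -- the random tensor, with its expected norm and the tail of its norm
          (∀ g g' : Fin N × Fin N × Fin N → Ω → ℂ,
            GaussTensor.IsIID (Sum.elim g g') (γ 1) P →
            Integrable (fun ω => GaussTensor.injectiveNorm
              (GaussTensor.bigTensor (fun p => g p ω) (fun p => g' p ω))) P ∧
            ∫ ω, GaussTensor.injectiveNorm
              (GaussTensor.bigTensor (fun p => g p ω) (fun p => g' p ω)) ∂P
                ≤ C * Real.log N ^ (3 / 2 : ℝ) * N ∧
            P {ω | C * Real.log N ^ (3 / 2 : ℝ) * N < GaussTensor.injectiveNorm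
                (GaussTensor.bigTensor (fun p => g p ω) (fun p => g' p ω))}
              ≤ ENNReal.ofReal (Real.exp (-(c * N))))) := by
  refine ⟨214272, 1, by norm_num, one_pos, fun N hN Ω _ P _ => ?_⟩
  rw [one_mul]
  refine ⟨fun Y hY => ?_, fun γ hγ => ⟨fun Y Y' hY => ?_, fun g g' hg => ?_⟩⟩
  · have h := hY.sqrt_mul (Or.inr rfl) (by omega)
    have hm := aemeasurable_pi_lambda _ fun p => (h.1 p).aemeasurable
    exact GaussTensor.measure_not_opNorm_le hN h.tripMoment_self hm hm
  · have h := hY.sqrt_mul hγ (by omega)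
    have e : (fun i ω => ((√N : ℝ) : ℂ)
        * Sum.elim (GaussTensor.entries Y) (GaussTensor.entries Y') i ω)
        = Sum.elim (fun p ω => ((√N : ℝ) : ℂ) * GaussTensor.entries Y p ω)
          (fun p ω => ((√N : ℝ) : ℂ) * GaussTensor.entries Y' p ω) := by
      ext (p | p) <;> rfl
    rw [e] at h
    exact GaussTensor.measure_not_opNorm_le hN (h.tripMoment_pair hγ)
      (aemeasurable_pi_lambda _ fun p => (h.1 (Sum.inl p)).aemeasurable)
      (aemeasurable_pi_lambda _ fun p => (h.1 (Sum.inr p)).aemeasurable)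
  · exact (hg.tripMoment_pair hγ).injectiveNorm_bounds
      (aemeasurable_pi_lambda _ fun p => (hg.1 (Sum.inl p)).aemeasurable)
      (aemeasurable_pi_lambda _ fun p => (hg.1 (Sum.inr p)).aemeasurable) hN
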